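/- Let $\alpha_0,\dots,\alpha_p\in\mathbb{R}$ be such that the $(p+1)\times(p+1)$ matrix with entries $\alpha_{|\ell-m|}$ is positive definite. Consider the class $\mathcal{B}$ of all real stochastic processes $X_1,X_2,\dots$ with $$\mathbb{E}[X_iX_{i+k}]=\alpha_k\qquad\text{for all } i\ge 1,\ k\in\{0,\dots,p\}.$$ For $\alpha>0$, $\alpha\neq1$, the order-$\alpha$ Rényi entropy of a probability density $f$ on $\mathbb{R}^n$ is $h_\alpha(f)=\frac1{1-\alpha}\log\int_{\mathbb{R}^n} f^\alpha\,dx$ (if the integral is infinite, this is $+\infty$ for $\alpha<1$ and $-\infty$ for $\alpha>1$), and its Shannon entropy is $h(f)=-\int f\log f\,dx$ whenever this integral exists in $[-\infty,+\infty]$. The order-$\alpha$ Rényi rate of a process for which every vector $(X_1,\dots,X_n)$ has a density $f_n$ is $\lim_{n\to\infty}\frac1n h_\alpha(f_n)\in[-\infty,+\infty]$ whenever the limit exists; the Shannon rate is $\lim_{n\to\infty}\frac1n h(f_n)$ whenever these entropies and the limit exist. A $p$-th order Gauss–Markov process with coefficients $a_1,\dots,a_p$ and innovation variance $\sigma^2$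 is a process satisfying $X_i=\sum_{k=1}^p a_kX_{i-k}+Z_i$ for $i\ge1$, where $Z_1,Z_2,\dots$ are i.i.d. $N(0,\sigma^2)$ and independent of the centered Gaussian vector $(X_{1-p},\dots,X_0)$, whose covariance matrix is the $p\times p$ matrix with entries $\alpha_{|\ell-m|}$. Then the following hold. 1. For every $0<\alpha<1$, the supremum of the order-$\alpha$ Rényi rate, over all processes in $\mathcal{B}$ whose order-$\alpha$ Rényi rate is defined, is $+\infty$. 2. There is a $p$-th order Gauss–Markov process, for some $a_1,\dots,a_p$ and $\sigma^2$, that belongs to $\mathcal{B}$. For every such process $\sigma^2>0$, its Shannon rate is defined and equals $\frac12\log(2\pi e\sigma^2)$, and for every $\alpha>1$ the supremum of the order-$\alpha$ Rényi rate, over all processes in $\mathcal{B}$ whose order-$\alpha$ Rényi rate is defined, equals this Shannon rate $\frac12\log(2\pi e\sigma^2)$. -/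

import Mathlib

open MeasureTheory ProbabilityTheory Filter Topology
open scoped ENNReal NNReal

universe u

/-- The `n × n` symmetric Toeplitz matrix with entries `γ |l - m|`. -/
def toeplitz (γ : ℕ → ℝ) (n : ℕ) : Matrix (Fin n) (Fin n) ℝ :=
  Matrix.of fun l m => γ ((l : ℤ) - (m : ℤ)).natAbs

noncomputable section

/-- The order-`α` Rényi entropy `(1 - α)⁻¹ log ∫ f ^ α` of a density `f` on `ℝⁿ`, with values in
`[-∞, ∞]`. If the integral is infinite, the value is `⊤` for `0 < α < 1` and `⊥` for `1 < α`. -/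
def renyiEntropy (α : ℝ) {n : ℕ} (f : (Fin n → ℝ) → ℝ≥0∞) : EReal :=
  (((1 - α)⁻¹ : ℝ) : EReal) * ENNReal.log (∫⁻ x, f x ^ α)

/-- The integral of the positive part of `-f log f`. -/
def shannonPos {n : ℕ} (f : (Fin n → ℝ) → ℝ≥0∞) : ℝ≥0∞ :=
  ∫⁻ x, ENNReal.ofReal (Real.negMulLog (f x).toReal)

/-- The integral of the negative part of `-f log f`. -/
def shannonNeg {n : ℕ} (f : (Fin n → ℝ) → ℝ≥0∞) : ℝ≥0∞ :=
  ∫⁻ x, ENNReal.ofReal (-Real.negMulLog (f x).toReal)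

/-- The integral `-∫ f log f` exists in `[-∞, ∞]`. -/
def ShannonEntropyExists {n : ℕ} (f : (Fin n → ℝ) → ℝ≥0∞) : Prop :=
  shannonPos f ≠ ⊤ ∨ shannonNeg f ≠ ⊤

/-- The (differential) Shannon entropy `-∫ f log f`, meaningful if `ShannonEntropyExists f`. -/
def shannonEntropy {n : ℕ} (f : (Fin n → ℝ) → ℝ≥0∞) : EReal :=
  (shannonPos f : EReal) - (shannonNeg f : EReal)

section Processes

variable {Ω : Type u} [MeasurableSpace Ω]

/-! A process `X₁, X₂, …` is a sequence `X : ℕ → Ω → ℝ`, where `X i` stands for `X_{i+1}`. -/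

/-- The random vector made of the first `n` members of the process. -/
def initialBlock (X : ℕ → Ω → ℝ) (n : ℕ) : Ω → Fin n → ℝ := fun ω i => X i ω

/-- The order-`α` Rényi rate of `X` is defined and equals `r`: all the initial blocks have
densities, and their normalized Rényi entropies tend to `r` in `[-∞, ∞]`. -/
def HasRenyiRate (α : ℝ) (P : Measure Ω) (X : ℕ → Ω → ℝ) (r : EReal) : Prop :=
  (∀ n, HasPDF (initialBlock X n) P volume) ∧
    Tendsto (fun n : ℕ => (((n : ℝ)⁻¹ : ℝ) : EReal) *
      renyiEntropy α (pdf (initialBlock X n) P volume)) atTop (𝓝 r)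

/-- The Shannon rate of `X` is defined and equals `r`. -/
def HasShannonRate (P : Measure Ω) (X : ℕ → Ω → ℝ) (r : EReal) : Prop :=
  (∀ n, HasPDF (initialBlock X n) P volume ∧
      ShannonEntropyExists (pdf (initialBlock X n) P volume)) ∧
    Tendsto (fun n : ℕ => (((n : ℝ)⁻¹ : ℝ) : EReal) *
      shannonEntropy (pdf (initialBlock X n) P volume)) atTop (𝓝 r)

/-- `X` is a stochastic process on `(Ω, P)` with `E[X_i X_{i+k}] = γ k` for all `i` and all
`k ∈ {0, …, p}`. -/
structure SatisfiesBurg (γ : ℕ → ℝ) (p : ℕ) (P : Measure Ω) (X : ℕ → Ω → ℝ) : Prop where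
  measurable : ∀ i, Measurable (X i)
  integrable : ∀ i, ∀ k ≤ p, Integrable (fun ω => X i ω * X (i + k) ω) P
  moment : ∀ i, ∀ k ≤ p, ∫ ω, X i ω * X (i + k) ω ∂P = γ k

/-- `X` is a `p`-th order Gauss–Markov process with regression coefficients `a` and innovation
variance `v`: there are i.i.d. centered Gaussians `Z₁, Z₂, …` of variance `v`, and independently of
them a centered Gaussian vector `(X_{1-p}, …, X_0)` with second-moment matrix `toeplitz γ p`, such
that `X_i = a₁ X_{i-1} + ⋯ + a_p X_{i-p} + Z_i` for all `i ≥ 1`.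

Here `Y` is the process `X_{1-p}, …, X_0, X_1, …`, that is, `Y j` stands for `X_{j+1-p}`, and
`a k` stands for `a_{k+1}`. -/
def IsGaussMarkov (γ : ℕ → ℝ) (p : ℕ) (a : Fin p → ℝ) (v : ℝ≥0) (P : Measure Ω)
    (X : ℕ → Ω → ℝ) : Prop :=
  ∃ Y Z : ℕ → Ω → ℝ,
    (∀ j, Measurable (Y j)) ∧ (∀ i, Measurable (Z i)) ∧
    HasGaussianLaw (initialBlock Y p) P ∧
    (∀ l : Fin p, ∫ ω, Y l ω ∂P = 0) ∧
    (∀ l m : Fin p, ∫ ω, Y l ω * Y m ω ∂P = toeplitz γ p l m) ∧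
    (∀ i, HasLaw (Z i) (gaussianReal 0 v) P) ∧
    iIndepFun Z P ∧
    IndepFun (initialBlock Y p) (fun ω i => Z i ω) P ∧
    (∀ i ω, Y (i + p) ω = (∑ k : Fin p, a k * Y (i + p - (k + 1)) ω) + Z i ω) ∧
    (∀ i, X i = Y (i + p))

end Processes

/-- The set of all order-`α` Rényi rates of processes with `E[X_i X_{i+k}] = γ k` for `k ≤ p`
whose order-`α` Rényi rate is defined. -/
def burgRenyiRates (γ : ℕ → ℝ) (p : ℕ) (α : ℝ) : Set EReal :=
  {r | ∃ (Ω : Type u) (_ : MeasurableSpace Ω) (P : Measure Ω) (X : ℕ → Ω → ℝ),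
    IsProbabilityMeasure P ∧ SatisfiesBurg γ p P X ∧ HasRenyiRate α P X r}

end

/-! Let `a`, `v` solve the Yule–Walker equations. Sending a path to its first `p` values followed by
the residuals `x_i - ∑ a_k x_{i-k}` is a unitriangular linear map, so it preserves volume and
entropy. For every process with the prescribed moments each residual has second moment exactly `v`.
The question thus becomes one about the entropy rate of noise of variance `v`.

Upper bound, order above one. Rényi entropy of such an order is at most Shannon entropy, which is at
most the cross entropy with any subprobability density; `renyiEntropy_le_crossEntropy` merges both
steps into one pointwise inequality, so the Shannon entropy need not exist. The reference density is
a product of Gaussians in the innovation coordinates. Its logarithm is quadratic, so the prescribed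
moments alone determine the cross entropy, which is `n · ½ log(2πe v) + O(1)`
(`SatisfiesBurg.renyiEntropy_le`).

Lower bounds. The moment constraint sees the driving noise only through its second moments, so white
noise suffices: independent copies of a vector in `ℝᵐ` are concatenated whose coordinates are
uncorrelated with variance `v` but may be dependent. By volume preservation the Rényi integral of a
path is the product of those of the initial vector and of the blocks (`exists_block_process`), and
the rate is `1/m` times the entropy of a block. Above order one the block is uniform on a ball of
`ℝ²ᵏ`: its Rényi entropy of every order is the log-volume, and Stirling's formula gives `½ log(2πe
v)` per coordinate as `k → ∞`. Below order one the block has a density decaying like `‖x‖^-(m+3)`: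
variances are finite, but the `α`-th power is not integrable once `(m+3)α < m`. A single block then
makes the entropy infinite, and the supremum is attained.

For a Gauss–Markov process in the class the moments force Yule–Walker, hence `v > 0`. The covariance
of its first `p + n` members has determinant `det T_p · vⁿ`, with `T_p` the Toeplitz matrix of size
`p`, and this yields the Shannon rate. -/

/-! ### The Yule–Walker equations -/

/-- The Yule–Walker equations for the regression coefficients `a` and the innovation
variance `v`. -/
def YuleWalker (γ : ℕ → ℝ) (p : ℕ) (a : Fin p → ℝ) (v : ℝ) : Prop :=
  (∀ l : Fin p, ∑ k : Fin p, a k * γ ((k : ℤ) - (l : ℤ)).natAbs = γ (l + 1)) ∧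
    ∑ k : Fin p, a k * γ (k + 1) + v = γ 0

lemma toeplitz_castLE_posDef {γ : ℕ → ℝ} {n m : ℕ} (h : (toeplitz γ m).PosDef) (hnm : n ≤ m) :
    (toeplitz γ n).PosDef := by
  have := h.submatrix (Fin.castLE_injective hnm)
  convert this using 1
  ext i j
  rfl

/-- The linear prediction error `v` is the value of the quadratic form of `toeplitz γ (p + 1)` at
the nonzero vector `(1, -a)`. -/
lemma YuleWalker.pos {γ : ℕ → ℝ} {p : ℕ} {a : Fin p → ℝ} {v : ℝ} (h : YuleWalker γ p a v)
    (hγ : (toeplitz γ (p + 1)).PosDef) : 0 < v := by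
  have hw : (Fin.cons 1 (-a) : Fin (p + 1) → ℝ) ≠ 0 := by
    intro h0
    have := congrFun h0 0
    simp at this
  have := hγ.dotProduct_mulVec_pos hw
  have e : star (Fin.cons 1 (-a) : Fin (p + 1) → ℝ) ⬝ᵥ
      (toeplitz γ (p + 1)).mulVec (Fin.cons 1 (-a)) = v := by
    have e1 : ∀ k : Fin p, (-1 + -(k : ℤ)).natAbs = k + 1 := fun k => by omega
    have e2 : ∀ k : Fin p, ((k : ℤ) + 1).natAbs = k + 1 := fun k => by omega
    have e3 : ∀ l : Fin p, ∑ k : Fin p, γ ((l : ℤ) - (k : ℤ)).natAbs * a k = γ (l + 1) := by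
      intro l
      rw [← h.1 l]
      refine Finset.sum_congr rfl fun k _ => ?_
      rw [mul_comm, ← Int.natAbs_neg, neg_sub]
    have h2 := h.2
    simp only [dotProduct, Matrix.mulVec, toeplitz, Fin.sum_univ_succ, Matrix.of_apply]
    simp [e1, e2, e3]
    simp only [mul_comm] at h2 ⊢
    linarith
  rwa [e] at this

lemma exists_yuleWalker {γ : ℕ → ℝ} {p : ℕ} (hγ : (toeplitz γ (p + 1)).PosDef) :
    ∃ (a : Fin p → ℝ) (v : ℝ), YuleWalker γ p a v := by
  have h := toeplitz_castLE_posDef hγ (Nat.le_succ p)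
  -- The value of `v` is left open; the second equation, read as its definition, fixes it.
  refine ⟨(toeplitz γ p)⁻¹.mulVec fun l => γ (l + 1), _, fun l => ?_, by
    rw [add_sub_cancel]⟩
  have : (toeplitz γ p).mulVec ((toeplitz γ p)⁻¹.mulVec fun l : Fin p => γ (l + 1)) =
      fun l : Fin p => γ (l + 1) := by
    rw [Matrix.mulVec_mulVec, Matrix.mul_nonsing_inv _ h.det_pos.ne'.isUnit, Matrix.one_mulVec]
  rw [← congrFun this l]
  refine Finset.sum_congr rfl fun k _ => ?_
  rw [mul_comm, ← Int.natAbs_neg, neg_sub]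
  rfl

/-! ### Autoregressions as recursions in a Hilbert space -/

section Hilbert

variable {H : Type*} [NormedAddCommGroup H] [InnerProductSpace ℝ H] {p : ℕ} {a : Fin p → ℝ}
  {y z : ℕ → H}

open scoped InnerProductSpace

/-- Causality: unrolling the recursion, `y j` combines initial values with noises `z m`, `m + p ≤
j`, and for `j < i + p` all of these are orthogonal to `z i`. -/
lemma inner_noise_past (hrec : ∀ i, y (i + p) = ∑ k : Fin p, a k • y (i + p - (k + 1)) + z i)
    (hz : ∀ i j, j < i → ⟪z i, z j⟫_ℝ = 0) (hy : ∀ i, ∀ l < p, ⟪z i, y l⟫_ℝ = 0) (i j : ℕ)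
    (hj : j < i + p) : ⟪z i, y j⟫_ℝ = 0 := by
  induction j using Nat.strong_induction_on with
  | _ j ih =>
    rcases lt_or_ge j p with h | h
    · exact hy i j h
    · obtain ⟨m, rfl⟩ := Nat.exists_eq_add_of_le' h
      rw [hrec, inner_add_right, inner_sum, hz i m (by omega), add_zero]
      refine Finset.sum_eq_zero fun k _ => ?_
      rw [inner_smul_right, ih _ (by omega) (by omega), mul_zero]

/-- Pairing the recursion at index `n + p` with its predecessors reproduces the first Yule–Walker
system, pairing it with itself the second equation. -/
lemma inner_autoregression {γ : ℕ → ℝ} {v : ℝ} (hyw : YuleWalker γ p a v)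
    (hrec : ∀ i, y (i + p) = ∑ k : Fin p, a k • y (i + p - (k + 1)) + z i)
    (hz : ∀ i j, j < i → ⟪z i, z j⟫_ℝ = 0) (hv : ∀ i, ⟪z i, z i⟫_ℝ = v)
    (hy : ∀ i, ∀ l < p, ⟪z i, y l⟫_ℝ = 0)
    (hinit : ∀ l < p, ∀ m < p, ⟪y l, y m⟫_ℝ = γ ((l : ℤ) - (m : ℤ)).natAbs) (i k : ℕ)
    (hk : k ≤ p) : ⟪y i, y (i + k)⟫_ℝ = γ k := by
  have hpast := inner_noise_past hrec hz hy
  -- The induction enlarges the window of indices with known moments, starting from the initial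
  -- block at `n = 0`.
  suffices H : ∀ n i k, k ≤ p → i + k < n + p → ⟪y i, y (i + k)⟫_ℝ = γ k from
    H (i + k + 1) i k hk (by omega)
  intro n
  induction n with
  | zero =>
    intro i k _ h
    rw [hinit i (by omega) _ (by omega)]
    congr 1
    omega
  | succ n ih =>
    have past : ∀ l : Fin p, ⟪y (n + p - (l + 1)), y (n + p)⟫_ℝ = γ (l + 1) := by
      intro l
      rw [hrec, inner_add_right, inner_sum, real_inner_comm, hpast n _ (by omega), add_zero,
        ← hyw.1 l]
      refine Finset.sum_congr rfl fun m _ => ?_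
      rw [inner_smul_right]
      congr 1
      rcases le_total (l : ℕ) m with h | h
      · have := ih (n + p - (m + 1)) (m - l) (by omega) (by omega)
        rw [real_inner_comm]
        convert this using 3 <;> omega
      · have := ih (n + p - (l + 1)) (l - m) (by omega) (by omega)
        convert this using 3 <;> omega
    intro i k hk h
    rcases lt_or_ge (i + k) (n + p) with h' | h'
    · exact ih i k hk h'
    · have hik : i + k = n + p := by omega
      rcases Nat.eq_zero_or_pos k with rfl | hk0
      · have hi : i = n + p := by omega
        subst hi
        have h1 : ⟪y (n + p), z n⟫_ℝ = v := by
          rw [hrec, inner_add_left, sum_inner, hv, Finset.sum_eq_zero, zero_add]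
          intro m _
          rw [inner_smul_left, real_inner_comm, hpast n _ (by omega), mul_zero]
        have h2 : ⟪y (n + p), y (n + p)⟫_ℝ =
            ∑ m : Fin p, a m * ⟪y (n + p), y (n + p - (m + 1))⟫_ℝ + ⟪y (n + p), z n⟫_ℝ := by
          conv_lhs => rw [hrec n, inner_add_right, inner_sum]
          rw [← hrec n]
          simp only [inner_smul_right]
        rw [add_zero, h2, h1, ← hyw.2]
        congr 1
        refine Finset.sum_congr rfl fun m _ => ?_
        rw [real_inner_comm, past]
      · have := past ⟨k - 1, by omega⟩
        rw [hik]
        convert this using 3 <;> simp <;> omega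

/-- By Yule–Walker the residual is orthogonal to the `p` vectors it regresses on, so its squared
norm is its inner product with `y (i + p)`. Only lags up to `p` enter, so no recursion for `y` is
needed. -/
lemma inner_innovation {γ : ℕ → ℝ} {v : ℝ} (hyw : YuleWalker γ p a v)
    (hy : ∀ i, ∀ k ≤ p, ⟪y i, y (i + k)⟫_ℝ = γ k) (i : ℕ) :
    ⟪y (i + p) - ∑ k : Fin p, a k • y (i + p - (k + 1)),
      y (i + p) - ∑ k : Fin p, a k • y (i + p - (k + 1))⟫_ℝ = v := by
  have hy' : ∀ i j, i ≤ j → j ≤ i + p → ⟪y i, y j⟫_ℝ = γ ((i : ℤ) - j).natAbs := by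
    intro i j h1 h2
    obtain ⟨k, rfl⟩ := Nat.exists_eq_add_of_le h1
    rw [hy i k (by omega)]
    congr 1; omega
  have h0 : ∀ l : Fin p, ⟪y (i + p - (l + 1)),
      y (i + p) - ∑ k : Fin p, a k • y (i + p - (k + 1))⟫_ℝ = 0 := by
    intro l
    rw [inner_sub_right, inner_sum, hy' _ _ (by omega) (by omega), sub_eq_zero]
    have : (((i + p - (l + 1) : ℕ) : ℤ) - ((i + p : ℕ) : ℤ)).natAbs = l + 1 := by omega
    rw [this, ← hyw.1 l]
    refine Finset.sum_congr rfl fun m _ => ?_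
    rw [inner_smul_right]
    congr 1
    rcases le_total (l : ℕ) m with h | h
    · rw [real_inner_comm, hy' _ _ (by omega) (by omega)]
      congr 1; omega
    · rw [hy' _ _ (by omega) (by omega)]
      congr 1; omega
  rw [inner_sub_left, sum_inner]
  simp only [inner_smul_left, h0, mul_zero, Finset.sum_const_zero, sub_zero]
  rw [inner_sub_right, inner_sum, hy' _ _ le_rfl (by omega), sub_eq_iff_eq_add]
  have h2 := hyw.2
  simp only [sub_self, Int.natAbs_zero]
  rw [← h2, add_comm]
  congr 1
  refine Finset.sum_congr rfl fun m _ => ?_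
  rw [inner_smul_right, real_inner_comm, hy' _ _ (by omega) (by omega)]
  congr 2; omega

/-- Moments are known only from index `p` on, so the recursion is read at index `p + p`, whose `p`
predecessors all lie in that range. -/
lemma yuleWalker_of_inner {γ : ℕ → ℝ} {v : ℝ}
    (hrec : ∀ i, y (i + p) = ∑ k : Fin p, a k • y (i + p - (k + 1)) + z i)
    (hz : ∀ i j, j < i → ⟪z i, z j⟫_ℝ = 0) (hv : ∀ i, ⟪z i, z i⟫_ℝ = v)
    (hy : ∀ i, ∀ l < p, ⟪z i, y l⟫_ℝ = 0)
    (hx : ∀ i, ∀ k ≤ p, ⟪y (i + p), y (i + k + p)⟫_ℝ = γ k) : YuleWalker γ p a v := by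
  have hpast := inner_noise_past hrec hz hy
  have hy' : ∀ i j, p ≤ i → i ≤ j → j ≤ i + p → ⟪y i, y j⟫_ℝ = γ ((i : ℤ) - j).natAbs := by
    intro i j h0 h1 h2
    obtain ⟨k, rfl⟩ := Nat.exists_eq_add_of_le h1
    obtain ⟨n, rfl⟩ := Nat.exists_eq_add_of_le' h0
    have := hx n k (by omega)
    rw [show n + p + k = n + k + p by omega, this]
    congr 1; omega
  constructor
  · intro l
    have h1 := hy' (p + p - (l + 1)) (p + p) (by omega) (by omega) (by omega)
    have : (((p + p - (l + 1) : ℕ) : ℤ) - ((p + p : ℕ) : ℤ)).natAbs = l + 1 := by omega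
    rw [this] at h1
    rw [← h1, hrec, inner_add_right, inner_sum, real_inner_comm (z p), hpast p _ (by omega),
      add_zero]
    refine Finset.sum_congr rfl fun m _ => ?_
    rw [inner_smul_right]
    congr 1
    rcases le_total (l : ℕ) m with h | h
    · rw [real_inner_comm, hy' _ _ (by omega) (by omega) (by omega)]
      congr 1; omega
    · rw [hy' _ _ (by omega) (by omega) (by omega)]
      congr 1; omega
  · have h1 : ⟪y (p + p), z p⟫_ℝ = v := by
      rw [hrec, inner_add_left, sum_inner, hv, Finset.sum_eq_zero, zero_add]
      intro m _
      rw [inner_smul_left, real_inner_comm, hpast p _ (by omega), mul_zero]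
    have h2 : ⟪y (p + p), y (p + p)⟫_ℝ =
        ∑ m : Fin p, a m * ⟪y (p + p), y (p + p - (m + 1))⟫_ℝ + ⟪y (p + p), z p⟫_ℝ := by
      conv_lhs => rw [hrec p, inner_add_right, inner_sum]
      rw [← hrec p]
      simp only [inner_smul_right]
    rw [h1, hy' _ _ (by omega) le_rfl (by omega), sub_self, Int.natAbs_zero] at h2
    rw [h2]
    congr 1
    refine Finset.sum_congr rfl fun m _ => ?_
    rw [real_inner_comm, hy' _ _ (by omega) (by omega) (by omega)]
    congr 2; omega

end Hilbert

/-! ### Transfer to random variables through `L²` -/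

section SecondMoments

variable {Ω : Type*} [MeasurableSpace Ω] {P : Measure Ω}

open scoped InnerProductSpace

lemma inner_toLp {f g : Ω → ℝ} (hf : MemLp f 2 P) (hg : MemLp g 2 P) :
    ⟪hf.toLp f, hg.toLp g⟫_ℝ = ∫ ω, f ω * g ω ∂P := by
  rw [L2.inner_def]
  refine integral_congr_ae ?_
  filter_upwards [hf.coeFn_toLp, hg.coeFn_toLp] with ω h1 h2
  simp [h1, h2, mul_comm]

lemma toLp_linearCombination {ι : Type*} [Fintype ι] {f : ι → Ω → ℝ}
    (hf : ∀ i, MemLp (f i) 2 P) (c : ι → ℝ) :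
    MemLp (fun ω => ∑ i, c i * f i ω) 2 P ∧
      ∀ h : MemLp (fun ω => ∑ i, c i * f i ω) 2 P, h.toLp _ = ∑ i, c i • (hf i).toLp (f i) := by
  have hm : MemLp (fun ω => ∑ i, c i * f i ω) 2 P :=
    memLp_finsetSum _ fun i _ => (hf i).const_mul (c i)
  refine ⟨hm, fun h => Lp.ext ?_⟩
  have h1 : ∀ᵐ ω ∂P, ∀ i, (c i • (hf i).toLp (f i)) ω = c i * f i ω := by
    rw [ae_all_iff]
    intro i
    filter_upwards [(hf i).coeFn_toLp, Lp.coeFn_smul (c i) ((hf i).toLp (f i))] with ω h2 h3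
    simp [h3, h2]
  filter_upwards [h.coeFn_toLp, Lp.coeFn_finsetSum Finset.univ
    (fun i => c i • (hf i).toLp (f i)), h1] with ω h2 h3 h4
  rw [h2, h3]
  simp only [Finset.sum_apply, h4]

variable {γ : ℕ → ℝ} {p : ℕ} {a : Fin p → ℝ} {v : ℝ} {X Y Z : ℕ → Ω → ℝ}

/-- `Y` is an autoregressive process driven by the white noise `Z` of variance `v`, which is
uncorrelated with the first `p` members of `Y`, whose second moments are `γ |l - m|`. -/
structure IsAutoregression (γ : ℕ → ℝ) (p : ℕ) (a : Fin p → ℝ) (v : ℝ) (P : Measure Ω)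
    (Y Z : ℕ → Ω → ℝ) : Prop where
  measurable : ∀ i, Measurable (Y i)
  measurable_noise : ∀ i, Measurable (Z i)
  memLp_init : ∀ l < p, MemLp (Y l) 2 P
  memLp_noise : ∀ i, MemLp (Z i) 2 P
  recursion : ∀ i ω, Y (i + p) ω = (∑ k : Fin p, a k * Y (i + p - (k + 1)) ω) + Z i ω
  noise_mul_noise : ∀ i j, j < i → ∫ ω, Z i ω * Z j ω ∂P = 0
  noise_sq : ∀ i, ∫ ω, Z i ω * Z i ω ∂P = v
  noise_mul_init : ∀ i, ∀ l < p, ∫ ω, Z i ω * Y l ω ∂P = 0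
  init_mul_init : ∀ l < p, ∀ m < p, ∫ ω, Y l ω * Y m ω ∂P = γ ((l : ℤ) - (m : ℤ)).natAbs

namespace IsAutoregression

lemma memLp (h : IsAutoregression γ p a v P Y Z) (i : ℕ) : MemLp (Y i) 2 P := by
  induction i using Nat.strong_induction_on with
  | _ i ih =>
    rcases lt_or_ge i p with hi | hi
    · exact h.memLp_init i hi
    · obtain ⟨m, rfl⟩ := Nat.exists_eq_add_of_le' hi
      rw [show Y (m + p) = _ from funext (h.recursion m)]
      exact ((toLp_linearCombination (fun k : Fin p => ih (m + p - (k + 1)) (by omega))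
        a).1).add (h.memLp_noise m)

lemma toLp_recursion (h : IsAutoregression γ p a v P Y Z) (i : ℕ) :
    (h.memLp (i + p)).toLp = ∑ k : Fin p, a k • (h.memLp (i + p - (k + 1))).toLp +
      (h.memLp_noise i).toLp := by
  have h1 := toLp_linearCombination (fun k : Fin p => h.memLp (i + p - (k + 1))) a
  rw [← h1.2 h1.1, ← MemLp.toLp_add]
  exact MemLp.toLp_congr _ _ (Eventually.of_forall (h.recursion i))

lemma satisfiesBurg (h : IsAutoregression γ p a v P Y Z) (hyw : YuleWalker γ p a v) :
    SatisfiesBurg γ p P Y where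
  measurable := h.measurable
  integrable i k _ := (h.memLp i).integrable_mul (h.memLp (i + k))
  moment i k hk := by
    have := inner_autoregression (y := fun i => (h.memLp i).toLp)
      (z := fun i => (h.memLp_noise i).toLp) hyw h.toLp_recursion
      (fun i j hij => (inner_toLp _ _).trans (h.noise_mul_noise i j hij))
      (fun i => (inner_toLp _ _).trans (h.noise_sq i))
      (fun i l hl => (inner_toLp _ _).trans (h.noise_mul_init i l hl))
      (fun l hl m hm => (inner_toLp _ _).trans (h.init_mul_init l hl m hm)) i k hk
    rwa [inner_toLp] at this

lemma noise_mul_past (h : IsAutoregression γ p a v P Y Z) (i j : ℕ) (hj : j < i + p) :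
    ∫ ω, Z i ω * Y j ω ∂P = 0 := by
  have := inner_noise_past (y := fun i => (h.memLp i).toLp)
      (z := fun i => (h.memLp_noise i).toLp) h.toLp_recursion
      (fun i j hij => (inner_toLp _ _).trans (h.noise_mul_noise i j hij))
      (fun i l hl => (inner_toLp _ _).trans (h.noise_mul_init i l hl)) i j hj
  rwa [inner_toLp] at this

lemma yuleWalker (h : IsAutoregression γ p a v P Y Z)
    (hX : SatisfiesBurg γ p P fun i => Y (i + p)) : YuleWalker γ p a v :=
  yuleWalker_of_inner (y := fun i => (h.memLp i).toLp)
      (z := fun i => (h.memLp_noise i).toLp) h.toLp_recursion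
      (fun i j hij => (inner_toLp _ _).trans (h.noise_mul_noise i j hij))
      (fun i => (inner_toLp _ _).trans (h.noise_sq i))
      (fun i l hl => (inner_toLp _ _).trans (h.noise_mul_init i l hl))
      (fun i k hk => (inner_toLp _ _).trans (hX.moment i k hk))

end IsAutoregression

namespace SatisfiesBurg

lemma memLp (h : SatisfiesBurg γ p P X) (i : ℕ) : MemLp (X i) 2 P := by
  rw [memLp_two_iff_integrable_sq (h.measurable i).aestronglyMeasurable]
  simpa [sq] using h.integrable i 0 (Nat.zero_le p)

lemma measurable_initialBlock (h : SatisfiesBurg γ p P X) (n : ℕ) :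
    Measurable (initialBlock X n) :=
  measurable_pi_lambda _ fun i => h.measurable i

lemma shift (h : SatisfiesBurg γ p P X) (n : ℕ) : SatisfiesBurg γ p P fun i => X (i + n) where
  measurable i := h.measurable _
  integrable i k hk := by simpa only [add_right_comm] using h.integrable (i + n) k hk
  moment i k hk := by simpa only [add_right_comm] using h.moment (i + n) k hk

lemma integral_innovation_sq (h : SatisfiesBurg γ p P X) (hyw : YuleWalker γ p a v) (i : ℕ) :
    ∫ ω, (X (i + p) ω - ∑ k : Fin p, a k * X (i + p - (k + 1)) ω) ^ 2 ∂P = v := by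
  have h1 := toLp_linearCombination (fun k : Fin p => h.memLp (i + p - (k + 1))) a
  have h2 := inner_innovation (y := fun i => (h.memLp i).toLp) hyw
    (fun i k hk => (inner_toLp _ _).trans (h.moment i k hk)) i
  rw [← h1.2 h1.1, ← MemLp.toLp_sub, inner_toLp] at h2
  simpa [sq] using h2

lemma integrable_innovation_sq (h : SatisfiesBurg γ p P X) (i : ℕ) :
    Integrable (fun ω => (X (i + p) ω - ∑ k : Fin p, a k * X (i + p - (k + 1)) ω) ^ 2) P :=
  ((h.memLp _).sub (toLp_linearCombination (fun k : Fin p => h.memLp (i + p - (k + 1)))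
    a).1).integrable_sq

end SatisfiesBurg

end SecondMoments

/-! ### Rényi integrals under products and linear maps -/

section Densities

lemma MeasurableEquiv.map_withDensity {E F : Type*} [MeasurableSpace E] [MeasurableSpace F]
    (T : E ≃ᵐ F) (μ : Measure E) (f : E → ℝ≥0∞) :
    (μ.withDensity f).map T = (μ.map T).withDensity (f ∘ T.symm) := by
  ext s hs
  rw [T.map_apply, withDensity_apply _ (T.measurable hs), withDensity_apply _ hs,
    T.restrict_map, lintegral_map_equiv]
  simp

/-- Concatenation of tuples as a measurable equivalence. -/
def finAppend (m n : ℕ) : (Fin m → ℝ) × (Fin n → ℝ) ≃ᵐ (Fin (m + n) → ℝ) :=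
  (Fin.appendHomeomorph m n).toMeasurableEquiv

@[simp]
lemma finAppend_apply (m n : ℕ) (x : (Fin m → ℝ) × (Fin n → ℝ)) :
    finAppend m n x = Fin.append x.1 x.2 := rfl

lemma volume_map_finAppend (m n : ℕ) :
    ((volume : Measure (Fin m → ℝ)).prod (volume : Measure (Fin n → ℝ))).map (finAppend m n) =
      volume := by
  refine (Measure.pi_eq fun s hs => ?_).symm
  have : finAppend m n ⁻¹' Set.univ.pi s =
      (Set.univ.pi fun i => s (Fin.castAdd n i)) ×ˢ (Set.univ.pi fun i => s (Fin.natAdd m i)) := by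
    ext x
    simp only [Set.mem_preimage, Set.mem_univ_pi, Set.mem_prod, finAppend_apply]
    constructor
    · exact fun h => ⟨fun i => by simpa using h (Fin.castAdd n i),
        fun i => by simpa using h (Fin.natAdd m i)⟩
    · rintro ⟨h1, h2⟩ i
      induction i using Fin.addCases with
      | left i => simpa using h1 i
      | right i => simpa using h2 i
  rw [MeasurableEquiv.map_apply, this, Measure.prod_prod, volume_pi_pi, volume_pi_pi,
    Fin.prod_univ_add]

/-- The integral of the `α`-th power of the density of `μ`. -/
noncomputable def renyiInt (α : ℝ) {n : ℕ} (μ : Measure (Fin n → ℝ)) : ℝ≥0∞ :=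
  ∫⁻ x, μ.rnDeriv volume x ^ α

variable {m n : ℕ} {α : ℝ}

lemma renyiInt_withDensity {f : (Fin n → ℝ) → ℝ≥0∞} (hf : Measurable f) :
    renyiInt α (volume.withDensity f) = ∫⁻ x, f x ^ α := by
  refine lintegral_congr_ae ?_
  filter_upwards [Measure.rnDeriv_withDensity volume hf] with x hx
  rw [hx]

lemma map_finAppend_withDensity {f : (Fin m → ℝ) → ℝ≥0∞} {g : (Fin n → ℝ) → ℝ≥0∞}
    (hf : Measurable f) (hg : Measurable g) :
    (((volume : Measure (Fin m → ℝ)).withDensity f).prod (volume.withDensity g)).map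
      (finAppend m n) =
      volume.withDensity
        ((fun z : (Fin m → ℝ) × (Fin n → ℝ) => f z.1 * g z.2) ∘ (finAppend m n).symm) := by
  rw [prod_withDensity hf hg, MeasurableEquiv.map_withDensity, volume_map_finAppend]

/-- The density of a product is the product of the densities and the `α`-th power is multiplicative,
so Tonelli splits the integral. -/
lemma renyiInt_finAppend (μ : Measure (Fin m → ℝ)) (ν : Measure (Fin n → ℝ))
    [IsFiniteMeasure μ] [IsFiniteMeasure ν] (hα : 0 ≤ α) (hμ : μ ≪ volume) (hν : ν ≪ volume) :
    renyiInt α ((μ.prod ν).map (finAppend m n)) = renyiInt α μ * renyiInt α ν := by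
  have h1 := Measure.withDensity_rnDeriv_eq _ _ hμ
  have h2 := Measure.withDensity_rnDeriv_eq _ _ hν
  have hf := Measure.measurable_rnDeriv μ volume
  have hg := Measure.measurable_rnDeriv ν volume
  have hm : Measurable ((fun z : (Fin m → ℝ) × (Fin n → ℝ) =>
      μ.rnDeriv volume z.1 * ν.rnDeriv volume z.2) ∘ (finAppend m n).symm) :=
    (hf.comp measurable_fst |>.mul (hg.comp measurable_snd)).comp (MeasurableEquiv.measurable _)
  conv_lhs => rw [← h1, ← h2, map_finAppend_withDensity hf hg]
  rw [renyiInt_withDensity hm, ← volume_map_finAppend, lintegral_map_equiv]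
  simp only [Function.comp_apply, MeasurableEquiv.symm_apply_apply]
  simp only [ENNReal.mul_rpow_of_nonneg _ _ hα]
  rw [lintegral_prod_mul (hf.pow_const α).aemeasurable (hg.pow_const α).aemeasurable]
  rfl

lemma absolutelyContinuous_map_finAppend {μ : Measure (Fin m → ℝ)} {ν : Measure (Fin n → ℝ)}
    [IsFiniteMeasure μ] [IsFiniteMeasure ν] (hμ : μ ≪ volume) (hν : ν ≪ volume) :
    (μ.prod ν).map (finAppend m n) ≪ volume := by
  rw [← volume_map_finAppend m n]
  exact (hμ.prod hν).map (finAppend m n).measurable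

/-- A linear automorphism of `ℝⁿ` as a measurable equivalence. -/
noncomputable def linEquiv (T : (Fin n → ℝ) ≃ₗ[ℝ] (Fin n → ℝ)) : (Fin n → ℝ) ≃ᵐ (Fin n → ℝ) :=
  T.toContinuousLinearEquiv.toHomeomorph.toMeasurableEquiv

@[simp]
lemma linEquiv_apply (T : (Fin n → ℝ) ≃ₗ[ℝ] (Fin n → ℝ)) (x : Fin n → ℝ) :
    linEquiv T x = T x := rfl

lemma det_linEquiv_ne_zero (T : (Fin n → ℝ) ≃ₗ[ℝ] (Fin n → ℝ)) :
    LinearMap.det (T : (Fin n → ℝ) →ₗ[ℝ] (Fin n → ℝ)) ≠ 0 :=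
  T.isUnit_det'.ne_zero

lemma volume_map_linEquiv (T : (Fin n → ℝ) ≃ₗ[ℝ] (Fin n → ℝ)) :
    (volume : Measure (Fin n → ℝ)).map (linEquiv T) =
      ENNReal.ofReal |(LinearMap.det (T : (Fin n → ℝ) →ₗ[ℝ] (Fin n → ℝ)))⁻¹| • volume :=
  Real.map_linearMap_volume_pi_eq_smul_volume_pi (det_linEquiv_ne_zero T)

lemma map_linEquiv_withDensity (T : (Fin n → ℝ) ≃ₗ[ℝ] (Fin n → ℝ)) {f : (Fin n → ℝ) → ℝ≥0∞}
    (hf : Measurable f) :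
    (volume.withDensity f).map (linEquiv T) =
      volume.withDensity fun x =>
        ENNReal.ofReal |(LinearMap.det (T : (Fin n → ℝ) →ₗ[ℝ] (Fin n → ℝ)))⁻¹| * f (T.symm x) := by
  rw [MeasurableEquiv.map_withDensity, volume_map_linEquiv, withDensity_smul_measure,
    ← withDensity_smul _ (hf.comp (linEquiv T).symm.measurable)]
  rfl

lemma absolutelyContinuous_map_linEquiv (T : (Fin n → ℝ) ≃ₗ[ℝ] (Fin n → ℝ))
    {μ : Measure (Fin n → ℝ)} (hμ : μ ≪ volume) : μ.map (linEquiv T) ≪ volume := by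
  refine (hμ.map (linEquiv T).measurable).trans ?_
  rw [volume_map_linEquiv]
  exact Measure.smul_absolutelyContinuous

/-- The density is scaled by `|det|⁻¹`, which contributes `|det|^(-α)`; the change of variables
contributes `|det|`. -/
lemma renyiInt_map_linEquiv (T : (Fin n → ℝ) ≃ₗ[ℝ] (Fin n → ℝ)) (μ : Measure (Fin n → ℝ))
    [IsFiniteMeasure μ] (hμ : μ ≪ volume) (hα : 0 ≤ α) :
    renyiInt α (μ.map (linEquiv T)) =
      ENNReal.ofReal (|LinearMap.det (T : (Fin n → ℝ) →ₗ[ℝ] (Fin n → ℝ))| ^ (1 - α)) *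
        renyiInt α μ := by
  set d := LinearMap.det (T : (Fin n → ℝ) →ₗ[ℝ] (Fin n → ℝ)) with hd
  have hd0 : 0 < |d| := abs_pos.2 (det_linEquiv_ne_zero T)
  have hf := Measure.measurable_rnDeriv μ volume
  conv_lhs => rw [← Measure.withDensity_rnDeriv_eq _ _ hμ, map_linEquiv_withDensity T hf]
  have hm : Measurable fun x => μ.rnDeriv volume (T.symm x) :=
    hf.comp (linEquiv T).symm.measurable
  rw [renyiInt_withDensity (hm.const_mul _)]
  simp only [ENNReal.mul_rpow_of_nonneg _ _ hα]
  have hg : Measurable fun x => μ.rnDeriv volume (T.symm x) ^ α :=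
    (hf.comp (linEquiv T).symm.measurable).pow_const α
  rw [lintegral_const_mul _ hg]
  have h1 : renyiInt α μ = ENNReal.ofReal |d⁻¹| * ∫⁻ x, μ.rnDeriv volume (T.symm x) ^ α := by
    rw [← smul_eq_mul, ← lintegral_smul_measure, ← volume_map_linEquiv, lintegral_map_equiv]
    simp [renyiInt]
  rw [h1, ← mul_assoc, ← ENNReal.ofReal_mul (by positivity), ← hd,
    ENNReal.ofReal_rpow_of_nonneg (abs_nonneg _) hα, abs_inv, Real.inv_rpow hd0.le,
    ← Real.rpow_neg hd0.le, ← Real.rpow_neg_one |d|, ← Real.rpow_add hd0]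
  congr 3
  ring

/-- Guards the products of Rényi integrals against `0 · ⊤` and the logarithms against `0`. -/
lemma renyiInt_ne_zero (μ : Measure (Fin n → ℝ)) [IsProbabilityMeasure μ] (hμ : μ ≪ volume)
    (hα : 0 < α) : renyiInt α μ ≠ 0 := by
  intro h
  rw [renyiInt, lintegral_eq_zero_iff ((Measure.measurable_rnDeriv μ volume).pow_const α)] at h
  have h0 : μ.rnDeriv volume =ᵐ[volume] 0 := by
    filter_upwards [h] with x hx
    exact (ENNReal.rpow_eq_zero_iff_of_pos hα).1 hx
  have h1 := Measure.withDensity_rnDeriv_eq _ _ hμ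
  rw [withDensity_congr_ae h0, withDensity_zero] at h1
  exact IsProbabilityMeasure.ne_zero μ h1.symm

/-- A density `f ≤ K` satisfies `f ^ α ≤ K ^ (α - 1) * f`, and `f` has finite integral. -/
lemma renyiInt_ne_top_of_le_smul {μ : Measure (Fin n → ℝ)} [IsProbabilityMeasure μ] {K : ℝ≥0∞}
    (hK : K ≠ ⊤) (hμ : μ ≤ K • volume) (hα : 1 < α) : renyiInt α μ ≠ ⊤ := by
  have h1 : μ.rnDeriv volume ≤ᵐ[volume] fun _ => K := by
    refine ae_le_of_forall_setLIntegral_le_of_sigmaFinite (Measure.measurable_rnDeriv μ volume)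
      fun s _ _ => (Measure.setLIntegral_rnDeriv_le s).trans ?_
    simpa using hμ s
  have h2 : renyiInt α μ ≤ ∫⁻ x, K ^ (α - 1) * μ.rnDeriv volume x := by
    refine lintegral_mono_ae ?_
    filter_upwards [h1, Measure.rnDeriv_ne_top μ volume] with x hx hx'
    rcases eq_or_ne (μ.rnDeriv volume x) 0 with h0 | h0
    · simp [h0, ENNReal.zero_rpow_of_pos (zero_lt_one.trans hα)]
    · calc μ.rnDeriv volume x ^ α = μ.rnDeriv volume x ^ (α - 1 + 1) := by ring_nf
        _ = μ.rnDeriv volume x ^ (α - 1) * μ.rnDeriv volume x := by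
          rw [ENNReal.rpow_add _ _ h0 hx', ENNReal.rpow_one]
        _ ≤ _ := by gcongr
  refine ne_top_of_le_ne_top ?_ h2
  rw [lintegral_const_mul _ (Measure.measurable_rnDeriv μ volume)]
  refine ENNReal.mul_ne_top (ENNReal.rpow_ne_top_of_nonneg (by linarith) hK) ?_
  exact ne_top_of_le_ne_top (measure_ne_top μ Set.univ) Measure.lintegral_rnDeriv_le

end Densities

/-! ### The volume-preserving passage to innovations -/

section InnovationMap

variable {p : ℕ}

/-- The map `x ↦ (x₁, …, x_p, x_{p+1} - ∑ a_k x_{p+1-k}, …)` from a path of an autoregressive process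
to its innovations. -/
def innovMap (a : Fin p → ℝ) (N : ℕ) : (Fin N → ℝ) →ₗ[ℝ] (Fin N → ℝ) where
  toFun x i := x i - if p ≤ (i : ℕ) then
    ∑ k : Fin p, a k * x ⟨i - (k + 1), lt_of_le_of_lt (Nat.sub_le _ _) i.2⟩ else 0
  map_add' x y := by
    ext i
    simp only [Pi.add_apply, mul_add, Finset.sum_add_distrib]
    split_ifs <;> ring
  map_smul' c x := by
    ext i
    simp only [Pi.smul_apply, smul_eq_mul, RingHom.id_apply, mul_left_comm _ c, ← Finset.mul_sum]
    split_ifs <;> ring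

lemma innovMap_apply_of_lt (a : Fin p → ℝ) {N : ℕ} (x : Fin N → ℝ) {i : Fin N} (hi : (i : ℕ) < p) :
    innovMap a N x i = x i := by
  simp [innovMap, not_le.2 hi]

lemma innovMap_apply_of_le (a : Fin p → ℝ) {N : ℕ} (x : Fin N → ℝ) {i : Fin N} (hi : p ≤ (i : ℕ)) :
    innovMap a N x i =
      x i - ∑ k : Fin p, a k * x ⟨i - (k + 1), lt_of_le_of_lt (Nat.sub_le _ _) i.2⟩ := by
  simp [innovMap, hi]

lemma det_innovMap (a : Fin p → ℝ) (N : ℕ) : LinearMap.det (innovMap a N) = 1 := by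
  rw [← LinearMap.det_toMatrix']
  have h0 : ∀ i j : Fin N, i ≤ j → LinearMap.toMatrix' (innovMap a N) i j =
      (Pi.single j 1 : Fin N → ℝ) i := by
    intro i j hij
    rw [LinearMap.toMatrix'_apply]
    rcases lt_or_ge (i : ℕ) p with h | h
    · rw [innovMap_apply_of_lt _ _ h]
    · rw [innovMap_apply_of_le _ _ h, Finset.sum_eq_zero, sub_zero]
      · intro k _
        rw [Fin.le_def] at hij
        -- As `k < p ≤ i`, the subtraction is not truncated, so this index lies strictly below `i ≤
        -- j`. The matrix is therefore lower triangular with unit diagonal.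
        have : (⟨i - (k + 1), lt_of_le_of_lt (Nat.sub_le _ _) i.2⟩ : Fin N) ≠ j := by
          intro h1
          have := congrArg Fin.val h1
          have := k.2
          simp only at *
          omega
        simp [this]
  rw [Matrix.det_of_isLowerTriangular]
  · simp [h0 _ _ le_rfl]
  · intro i j hij
    have hij' : i < j := hij
    rw [h0 i j hij'.le]
    simp [hij'.ne]

/-- The map `innovMap` as a linear automorphism. -/
noncomputable def innovEquiv (a : Fin p → ℝ) (N : ℕ) : (Fin N → ℝ) ≃ₗ[ℝ] (Fin N → ℝ) :=
  LinearEquiv.ofIsUnitDet (v := Pi.basisFun ℝ (Fin N)) (v' := Pi.basisFun ℝ (Fin N))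
    (f := innovMap a N) (by
      rw [LinearMap.det_toMatrix, det_innovMap]
      exact isUnit_one)

@[simp]
lemma innovEquiv_apply (a : Fin p → ℝ) (N : ℕ) (x : Fin N → ℝ) :
    innovEquiv a N x = innovMap a N x := rfl

lemma det_innovEquiv (a : Fin p → ℝ) (N : ℕ) :
    LinearMap.det (innovEquiv a N : (Fin N → ℝ) →ₗ[ℝ] (Fin N → ℝ)) = 1 := by
  rw [← det_innovMap a N]
  congr 1

lemma measurePreserving_innovEquiv (a : Fin p → ℝ) (N : ℕ) :
    MeasurePreserving (linEquiv (innovEquiv a N)) := by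
  refine ⟨MeasurableEquiv.measurable _, ?_⟩
  rw [volume_map_linEquiv, det_innovEquiv]
  simp

lemma innovMap_recursion {a : Fin p → ℝ} {y z : ℕ → ℝ}
    (h : ∀ i, y (i + p) = (∑ k : Fin p, a k * y (i + p - (k + 1))) + z i) (n : ℕ) :
    innovMap a (p + n) (fun i => y i) = Fin.append (fun l : Fin p => y l) (fun i : Fin n => z i) := by
  ext i
  induction i using Fin.addCases with
  | left i =>
    rw [innovMap_apply_of_lt _ _ (by simp), Fin.append_left]
    rfl
  | right i =>
    rw [innovMap_apply_of_le _ _ (by simp), Fin.append_right]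
    simp only [Fin.val_natAdd]
    rw [add_comm p, h]
    ring

end InnovationMap

/-! ### Upper bound for orders above one -/

section CrossEntropy

lemma EReal.coe_mul_le_of_neg {c d : ℝ} (hc : c < 0) {x : EReal} (h : (d : EReal) ≤ x) :
    (c : EReal) * x ≤ ((c * d : ℝ) : EReal) := by
  induction x with
  | bot => simp at h
  | top => rw [EReal.coe_mul_top_of_neg hc]; exact bot_le
  | coe x =>
    rw [← EReal.coe_mul, EReal.coe_le_coe_iff]
    exact mul_le_mul_of_nonpos_left (EReal.coe_le_coe_iff.1 h) hc.le

/-- The Rényi entropy of order `α > 1` is at most the cross entropy with respect to any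
subprobability density. -/
lemma renyiEntropy_le_crossEntropy {n : ℕ} {α : ℝ} (hα : 1 < α) (μ : Measure (Fin n → ℝ))
    [IsProbabilityMeasure μ] (hμ : μ ≪ volume) {g : (Fin n → ℝ) → ℝ} (hg0 : ∀ x, 0 < g x)
    (hgi : Integrable g) (hg1 : ∫ x, g x ≤ 1) (hlog : Integrable (fun x => Real.log (g x)) μ) :
    renyiEntropy α (μ.rnDeriv volume) ≤ ((-∫ x, Real.log (g x) ∂μ : ℝ) : EReal) := by
  set L := ∫ x, Real.log (g x) ∂μ with hL
  set f : (Fin n → ℝ) → ℝ := fun x => (μ.rnDeriv volume x).toReal with hf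
  have hα' : (1 - α)⁻¹ < 0 := inv_lt_zero.2 (by linarith)
  have key : (((α - 1) * L : ℝ) : EReal) ≤ ENNReal.log (renyiInt α μ) := by
    rcases eq_or_ne (renyiInt α μ) ⊤ with htop | htop
    · rw [htop]; simp
    have hfi : Integrable f := Measure.integrable_toReal_rnDeriv
    have hf1 : ∫ x, f x = 1 := by
      rw [Measure.integral_toReal_rnDeriv hμ]; simp
    have hfl : Integrable (fun x => f x * Real.log (g x)) := by
      simpa only [smul_eq_mul] using (integrable_rnDeriv_smul_iff hμ).2 hlog
    have hfl1 : ∫ x, f x * Real.log (g x) = L := by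
      simpa only [smul_eq_mul] using integral_rnDeriv_smul hμ (f := fun x => Real.log (g x))
    have hpow : ∀ x, (μ.rnDeriv volume x ^ α).toReal = f x ^ α := fun x =>
      (ENNReal.toReal_rpow _ _).symm
    have hm : Measurable fun x => μ.rnDeriv volume x ^ α :=
      (Measure.measurable_rnDeriv μ volume).pow_const α
    have hfa : Integrable (fun x => f x ^ α) := by
      simp only [← hpow]
      exact integrable_toReal_of_lintegral_ne_top hm.aemeasurable htop
    have hfa1 : ∫ x, f x ^ α = (renyiInt α μ).toReal := by
      simp only [← hpow]
      rw [integral_toReal hm.aemeasurable (ae_lt_top hm htop)]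
      rfl
    set c := (α - 1) * L with hc
    -- Jensen and Gibbs in one tangent-line bound: in `f ^ α = e^c * f * exp ((α - 1) log f - c)`
    -- use `exp t ≥ 1 + t` and `f log f ≥ f log g + f - g`. With this `c` the integrated terms `1 -
    -- c` and `(α - 1) L` add up to `1`, and `∫ g ≤ 1` makes the last term nonnegative.
    have hpt : ∀ x, Real.exp c * ((1 - c) * f x + (α - 1) * (f x * Real.log (g x)) +
        (α - 1) * (f x - g x)) ≤ f x ^ α := by
      intro x
      have hfx : 0 ≤ f x := ENNReal.toReal_nonneg
      rcases hfx.eq_or_lt with h0 | h0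
      · rw [← h0, Real.zero_rpow (by linarith)]
        have := hg0 x
        have h3 : 0 ≤ (α - 1) * g x := by
          apply mul_nonneg <;> linarith
        have := Real.exp_pos c
        nlinarith
      · have h1 : f x ^ α = Real.exp c * (f x * Real.exp ((α - 1) * Real.log (f x) - c)) := by
          rw [Real.exp_sub]
          have h2 : f x ^ α = f x * Real.exp ((α - 1) * Real.log (f x)) := by
            rw [mul_comm (α - 1), ← Real.rpow_def_of_pos h0, ← Real.rpow_one_add' h0.le (by linarith)]
            congr 1
            ring
          rw [h2]
          field_simp
        rw [h1]
        refine mul_le_mul_of_nonneg_left ?_ (Real.exp_pos c).le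
        have h2 := Real.add_one_le_exp ((α - 1) * Real.log (f x) - c)
        have h3 := Real.log_le_sub_one_of_pos (div_pos (hg0 x) h0)
        rw [Real.log_div (hg0 x).ne' h0.ne'] at h3
        have h4 : f x * (Real.log (g x) - Real.log (f x)) ≤ g x - f x := by
          calc _ ≤ f x * (g x / f x - 1) := mul_le_mul_of_nonneg_left h3 h0.le
            _ = _ := by field_simp
        have h5 := mul_le_mul_of_nonneg_left h2 h0.le
        have h6 := mul_le_mul_of_nonneg_left h4 (by linarith : 0 ≤ α - 1)
        nlinarith
    have hi1 : Integrable (fun x => (1 - c) * f x) := hfi.const_mul _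
    have hi2 : Integrable (fun x => (α - 1) * (f x * Real.log (g x))) := hfl.const_mul _
    have hi3 : Integrable (fun x => (α - 1) * (f x - g x)) := (hfi.sub hgi).const_mul _
    have hi12 : Integrable (fun x => (1 - c) * f x + (α - 1) * (f x * Real.log (g x))) :=
      hi1.add hi2
    have hint : Integrable (fun x => Real.exp c * ((1 - c) * f x +
        (α - 1) * (f x * Real.log (g x)) + (α - 1) * (f x - g x))) :=
      (hi12.add hi3).const_mul _
    have hmain := integral_mono hint hfa hpt
    rw [hfa1, integral_const_mul, integral_add hi12 hi3, integral_add hi1 hi2,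
      integral_const_mul, integral_const_mul, integral_const_mul, integral_sub hfi hgi, hf1, hfl1,
      ← hc] at hmain
    have hexp : Real.exp c ≤ (renyiInt α μ).toReal := by
      refine le_trans ?_ hmain
      have : 1 ≤ (1 - c) * 1 + c + (α - 1) * (1 - ∫ x, g x) := by
        have : 0 ≤ (α - 1) * (1 - ∫ x, g x) := mul_nonneg (by linarith) (by linarith)
        linarith
      nlinarith [Real.exp_pos c]
    calc (c : EReal) = ENNReal.log (ENNReal.ofReal (Real.exp c)) := by
          rw [ENNReal.log_ofReal_of_pos (Real.exp_pos c), Real.log_exp]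
      _ ≤ _ := ENNReal.log_le_log (ENNReal.ofReal_le_of_le_toReal hexp)
  refine (EReal.coe_mul_le_of_neg hα' key).trans (le_of_eq ?_)
  congr 1
  have : 1 - α ≠ 0 := by linarith
  field_simp
  ring

lemma log_gaussianPDFReal {v : ℝ≥0} (hv : v ≠ 0) (x : ℝ) :
    Real.log (gaussianPDFReal 0 v x) =
      -(1 / 2 * Real.log (2 * Real.pi * v)) - x ^ 2 / (2 * v) := by
  have hv' : (0 : ℝ) < v := by positivity
  rw [gaussianPDFReal, Real.log_mul (by positivity) (Real.exp_pos _).ne', Real.log_exp,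
    Real.log_inv, Real.log_sqrt (by positivity)]
  ring

variable {Ω : Type*} [MeasurableSpace Ω] {P : Measure Ω} [IsProbabilityMeasure P]
  {γ : ℕ → ℝ} {p : ℕ} {a : Fin p → ℝ} {v : ℝ≥0} {X : ℕ → Ω → ℝ}

/-- The log of the reference density is quadratic in the innovation coordinates; its mean uses only
the second moments `γ 0` of the initial values and `v` of the residuals. -/
lemma SatisfiesBurg.renyiEntropy_le (h : SatisfiesBurg γ p P X) (hyw : YuleWalker γ p a v)
    (hv : v ≠ 0) {α : ℝ} (hα : 1 < α) (n : ℕ)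
    (hX : HasPDF (initialBlock X (p + n)) P volume) :
    renyiEntropy α (pdf (initialBlock X (p + n)) P volume) ≤
      ((p * (1 / 2 * Real.log (2 * Real.pi) + γ 0 / 2) +
        n * (1 / 2 * Real.log (2 * Real.pi * Real.exp 1 * v)) : ℝ) : EReal) := by
  -- Unit variance on the first `p` coordinates is a convenience: their contribution does not depend
  -- on `n` and vanishes in the rate.
  set w : Fin (p + n) → ℝ≥0 := Fin.append (fun _ : Fin p => 1) (fun _ : Fin n => v) with hw
  have hw0 : ∀ i, w i ≠ 0 := by
    intro i
    induction i using Fin.addCases with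
    | left i => simp [hw]
    | right i => simpa [hw] using hv
  set g : (Fin (p + n) → ℝ) → ℝ :=
    fun x => ∏ i, gaussianPDFReal 0 (w i) (innovMap a (p + n) x i) with hg
  have hG := measurePreserving_innovEquiv a (p + n)
  have hgi : Integrable g :=
    (hG.integrable_comp_emb (MeasurableEquiv.measurableEmbedding _)).2
      (Integrable.fintype_prod fun i => integrable_gaussianPDFReal 0 (w i))
  have hg1 : ∫ x, g x = 1 := by
    have := hG.integral_comp' (g := fun x => ∏ i, gaussianPDFReal 0 (w i) (x i))
    refine this.trans ?_
    rw [integral_fintype_prod_volume_eq_prod]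
    exact Finset.prod_eq_one fun i _ => integral_gaussianPDFReal_eq_one 0 (hw0 i)
  have hm := h.measurable_initialBlock (p + n)
  have : IsProbabilityMeasure (P.map (initialBlock X (p + n))) :=
    Measure.isProbabilityMeasure_map hm.aemeasurable
  have hlogg : ∀ x, Real.log (g x) = ∑ i, (-(1 / 2 * Real.log (2 * Real.pi * w i)) -
      (innovMap a (p + n) x i) ^ 2 / (2 * w i)) := by
    intro x
    rw [hg, Real.log_prod fun i _ => (gaussianPDFReal_pos 0 (w i) _ (hw0 i)).ne']
    exact Finset.sum_congr rfl fun i _ => log_gaussianPDFReal (hw0 i) _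
  have hmG : ∀ i, Measurable fun x => innovMap a (p + n) x i := fun i =>
    (measurable_pi_apply i).comp (linEquiv (innovEquiv a (p + n))).measurable
  have hloggm : Measurable fun x => Real.log (g x) := by
    simp only [hlogg]
    exact Finset.measurable_fun_sum _ fun i _ => ((hmG i).pow_const 2 |>.div_const _).const_sub _
  have hinit : ∀ (l : Fin p) (ω : Ω), innovMap a (p + n) (initialBlock X (p + n) ω)
      (Fin.castAdd n l) = X l ω := by
    intro l ω
    rw [innovMap_apply_of_lt _ _ (by simp)]
    rfl
  have hinnov : ∀ (i : Fin n) (ω : Ω), innovMap a (p + n) (initialBlock X (p + n) ω)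
      (Fin.natAdd p i) = X (i + p) ω - ∑ k : Fin p, a k * X (i + p - (k + 1)) ω := by
    intro i ω
    rw [innovMap_apply_of_le _ _ (by simp)]
    simp only [initialBlock, Fin.val_natAdd, add_comm p]
  have hsq : ∀ i, Integrable
      (fun ω => (innovMap a (p + n) (initialBlock X (p + n) ω) i) ^ 2) P := by
    intro i
    induction i using Fin.addCases with
    | left l => simpa only [hinit] using (h.memLp l).integrable_sq
    | right i => simpa only [hinnov] using h.integrable_innovation_sq i
  have hterm : ∀ i, Integrable (fun ω => -(1 / 2 * Real.log (2 * Real.pi * w i)) -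
      (innovMap a (p + n) (initialBlock X (p + n) ω) i) ^ 2 / (2 * w i)) P := fun i =>
    (integrable_const _).sub ((hsq i).div_const _)
  have hlogi : Integrable (fun x => Real.log (g x)) (P.map (initialBlock X (p + n))) := by
    rw [integrable_map_measure hloggm.aestronglyMeasurable hm.aemeasurable]
    simp only [Function.comp_def, hlogg]
    exact integrable_finsetSum _ fun i _ => hterm i
  refine (renyiEntropy_le_crossEntropy hα _ hX.absolutelyContinuous
    (fun x => Finset.prod_pos fun i _ => gaussianPDFReal_pos 0 (w i) _ (hw0 i)) hgi hg1.le
    hlogi).trans (le_of_eq ?_)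
  congr 1
  rw [integral_map hm.aemeasurable hloggm.aestronglyMeasurable]
  simp only [hlogg]
  rw [integral_finsetSum _ fun i _ => hterm i]
  have hint : ∀ i, ∫ ω, (-(1 / 2 * Real.log (2 * Real.pi * w i)) -
      (innovMap a (p + n) (initialBlock X (p + n) ω) i) ^ 2 / (2 * w i)) ∂P =
      -(1 / 2 * Real.log (2 * Real.pi * w i)) -
      (∫ ω, (innovMap a (p + n) (initialBlock X (p + n) ω) i) ^ 2 ∂P) / (2 * w i) := by
    intro i
    rw [integral_sub (integrable_const _) ((hsq i).div_const _), integral_div]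
    simp
  simp only [hint]
  rw [Fin.sum_univ_add]
  have hX0 : ∀ l : Fin p, ∫ ω, X l ω ^ 2 ∂P = γ 0 := by
    intro l
    simpa [sq] using h.moment l 0 (Nat.zero_le p)
  simp only [hinit, hinnov, h.integral_innovation_sq hyw, hX0, hw, Fin.append_left,
    Fin.append_right, Finset.sum_const, Finset.card_univ, Fintype.card_fin, nsmul_eq_mul]
  have hv' : (0 : ℝ) < v := by positivity
  have : Real.log (2 * Real.pi * Real.exp 1 * v) = Real.log (2 * Real.pi * v) + 1 := by
    rw [mul_right_comm, Real.log_mul (by positivity) (by positivity), Real.log_exp]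
  rw [this]
  simp only [NNReal.coe_one, mul_one]
  field_simp
  ring

end CrossEntropy

/-! ### Gaussian vectors and their Shannon entropy -/

section GaussianEntropy

variable {n : ℕ}

lemma shannonEntropy_rnDeriv (μ : Measure (Fin n → ℝ)) [IsProbabilityMeasure μ]
    (hμ : μ ≪ volume) (hi : Integrable (llr μ volume) μ) :
    ShannonEntropyExists (μ.rnDeriv volume) ∧
      shannonEntropy (μ.rnDeriv volume) = ((-∫ x, llr μ volume x ∂μ : ℝ) : EReal) := by
  have h1 : Integrable fun x => Real.negMulLog (μ.rnDeriv volume x).toReal := by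
    have := ((integrable_rnDeriv_mul_log_iff hμ).2 hi).neg
    refine this.congr (Eventually.of_forall fun x => ?_)
    simp [Real.negMulLog]
  have h2 : ∫ x, Real.negMulLog (μ.rnDeriv volume x).toReal = -∫ x, llr μ volume x ∂μ := by
    rw [← integral_rnDeriv_mul_log hμ, ← integral_neg]
    simp [Real.negMulLog]
  have hp : shannonPos (μ.rnDeriv volume) ≠ ⊤ := h1.lintegral_lt_top.ne
  have hn : shannonNeg (μ.rnDeriv volume) ≠ ⊤ := h1.neg.lintegral_lt_top.ne
  refine ⟨Or.inl hp, ?_⟩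
  rw [← h2, integral_eq_lintegral_pos_part_sub_lintegral_neg_part h1, EReal.coe_sub,
    shannonEntropy, ← EReal.coe_ennreal_toReal hp, ← EReal.coe_ennreal_toReal hn]
  rfl

lemma pi_gaussianReal_eq_withDensity :
    Measure.pi (fun _ : Fin n => gaussianReal 0 1) =
      volume.withDensity fun x => ENNReal.ofReal (∏ i, gaussianPDFReal 0 1 (x i)) := by
  refine Measure.pi_eq fun s hs => ?_
  have hnn : ∀ x : Fin n → ℝ, 0 ≤ ∏ i, gaussianPDFReal 0 1 (x i) := fun x =>
    Finset.prod_nonneg fun i _ => gaussianPDFReal_nonneg _ _ _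
  rw [withDensity_apply _ (MeasurableSet.univ_pi hs), volume_pi, Measure.restrict_pi_pi,
    ← ofReal_integral_eq_lintegral_ofReal
      (Integrable.fintype_prod fun i => (integrable_gaussianPDFReal 0 1).restrict)
      (Eventually.of_forall hnn),
    integral_fintype_prod_eq_prod (fun _ => gaussianPDFReal 0 1),
    ENNReal.ofReal_prod_of_nonneg fun i _ => integral_nonneg fun x => gaussianPDFReal_nonneg _ _ _]
  refine Finset.prod_congr rfl fun i _ => ?_
  rw [gaussianReal_apply_eq_integral 0 one_ne_zero]

lemma integral_eval_pi_gaussianReal (i : Fin n) :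
    ∫ x, x i ∂(Measure.pi fun _ : Fin n => gaussianReal 0 1) = 0 := by
  rw [integral_eval]
  exact integral_id_gaussianReal

lemma memLp_eval_pi_gaussianReal (i : Fin n) :
    MemLp (fun x : Fin n → ℝ => x i) 2 (Measure.pi fun _ : Fin n => gaussianReal 0 1) :=
  (memLp_id_gaussianReal 2).comp_measurePreserving
    (measurePreserving_eval (fun _ : Fin n => gaussianReal 0 1) i)

lemma integral_eval_mul_eval_pi_gaussianReal (i j : Fin n) :
    ∫ x, x i * x j ∂(Measure.pi fun _ : Fin n => gaussianReal 0 1) = (1 : Matrix _ _ ℝ) i j := by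
  rcases eq_or_ne i j with rfl | hij
  · have hX : MeasurePreserving (fun x : Fin n → ℝ => x i)
        (Measure.pi fun _ : Fin n => gaussianReal 0 1) (gaussianReal 0 1) :=
      measurePreserving_eval (fun _ : Fin n => gaussianReal 0 1) i
    have h := variance_eq_sub (memLp_id_gaussianReal (μ := 0) (v := 1) 2)
    rw [variance_id_gaussianReal] at h
    rw [Matrix.one_apply_eq, ← integral_map (f := fun y : ℝ => y * y)
      hX.measurable.aemeasurable (by fun_prop), hX.map_eq]
    simpa [sq] using h.symm
  · have h1 := iIndepFun_pi (μ := fun _ : Fin n => gaussianReal 0 1)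
      (X := fun _ x => x) (fun i => aemeasurable_id)
    have := (h1.indepFun hij).integral_fun_mul_eq_mul_integral
      (measurable_pi_apply i).aestronglyMeasurable (measurable_pi_apply j).aestronglyMeasurable
    rw [this, integral_eval_pi_gaussianReal, zero_mul, Matrix.one_apply_ne hij]

/-- The characteristic function of a Gaussian law at a functional depends only on the mean and
variance of that functional, which expand into first and second coordinate moments. -/
lemma IsGaussian.ext_of_moments {μ ν : Measure (Fin n → ℝ)} [IsGaussian μ] [IsGaussian ν]
    (h1 : ∀ i, ∫ x, x i ∂μ = ∫ x, x i ∂ν)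
    (h2 : ∀ i j, ∫ x, x i * x j ∂μ = ∫ x, x i * x j ∂ν) : μ = ν := by
  have hev : ∀ (μ : Measure (Fin n → ℝ)) [IsGaussian μ] (i : Fin n),
      MemLp (fun x : Fin n → ℝ => x i) 2 μ := fun μ _ i =>
    IsGaussian.memLp_dual μ (ContinuousLinearMap.proj i) 2 (by simp)
  have hL : ∀ (L : StrongDual ℝ (Fin n → ℝ)) x, L x = ∑ i, L (Pi.single i 1) * x i := by
    intro L x
    conv_lhs => rw [← Finset.univ_sum_single x, map_sum]
    refine Finset.sum_congr rfl fun i _ => ?_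
    rw [mul_comm, ← smul_eq_mul (x i), ← map_smul, ← Pi.single_smul, smul_eq_mul, mul_one]
  have hm : ∀ (μ : Measure (Fin n → ℝ)) [IsGaussian μ] (L : StrongDual ℝ (Fin n → ℝ)),
      ∫ x, L x ∂μ = ∑ i, L (Pi.single i 1) * ∫ x, x i ∂μ := by
    intro μ _ L
    rw [show (fun x => L x) = _ from funext (hL L)]
    rw [integral_finsetSum _ fun i _ => ((hev μ i).integrable one_le_two).const_mul _]
    simp only [integral_const_mul]
  have hs : ∀ (μ : Measure (Fin n → ℝ)) [IsGaussian μ] (L : StrongDual ℝ (Fin n → ℝ)),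
      ∫ x, L x ^ 2 ∂μ =
        ∑ i, ∑ j, L (Pi.single i 1) * L (Pi.single j 1) * ∫ x, x i * x j ∂μ := by
    intro μ _ L
    have hx : ∀ x, L x ^ 2 =
        ∑ i, ∑ j, L (Pi.single i 1) * L (Pi.single j 1) * (x i * x j) := by
      intro x
      rw [hL L, sq, Finset.sum_mul_sum]
      refine Finset.sum_congr rfl fun i _ => Finset.sum_congr rfl fun j _ => by ring
    simp only [hx]
    have hi : ∀ i j, Integrable
        (fun x => L (Pi.single i 1) * L (Pi.single j 1) * (x i * x j)) μ :=
      fun i j => ((hev μ i).integrable_mul (hev μ j)).const_mul _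
    rw [integral_finsetSum _ fun i _ => integrable_finsetSum _ fun j _ => hi i j]
    refine Finset.sum_congr rfl fun i _ => ?_
    rw [integral_finsetSum _ fun j _ => hi i j]
    simp only [integral_const_mul]
  refine Measure.ext_of_charFunDual ?_
  ext L
  rw [IsGaussian.charFunDual_eq, IsGaussian.charFunDual_eq,
    variance_eq_sub (IsGaussian.memLp_dual μ L 2 (by simp)),
    variance_eq_sub (IsGaussian.memLp_dual ν L 2 (by simp))]
  have e1 : ∫ x, L x ∂μ = ∫ x, L x ∂ν := by simp only [hm, h1]
  have e2 : ∫ x, L x ^ 2 ∂μ = ∫ x, L x ^ 2 ∂ν := by simp only [hs, h2]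
  simp only [Pi.pow_apply, e1, e2, integral_complex_ofReal]

instance : IsGaussian (Measure.pi fun _ : Fin n => gaussianReal 0 1) := by
  have h := (iIndepFun_pi (μ := fun _ : Fin n => gaussianReal 0 1)
      (X := fun _ x => x) (fun i => aemeasurable_id)).hasGaussianLaw (fun i =>
        (measurePreserving_eval (fun _ : Fin n => gaussianReal 0 1) i).hasLaw.hasGaussianLaw)
  have := h.isGaussian_map
  rwa [Measure.map_id'] at this

lemma isGaussian_map_linEquiv (T : (Fin n → ℝ) ≃ₗ[ℝ] (Fin n → ℝ)) (μ : Measure (Fin n → ℝ))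
    [IsGaussian μ] : IsGaussian (μ.map (linEquiv T)) :=
  isGaussian_map_equiv T.toContinuousLinearEquiv

open scoped MatrixOrder in
-- The map is the symmetric square root of `S`, applied to a standard Gaussian vector.
lemma exists_map_linEquiv_moments {S : Matrix (Fin n) (Fin n) ℝ} (hS : S.PosDef) :
    ∃ T : (Fin n → ℝ) ≃ₗ[ℝ] (Fin n → ℝ),
      LinearMap.det (T : (Fin n → ℝ) →ₗ[ℝ] (Fin n → ℝ)) ^ 2 = S.det ∧
      (∀ i, ∫ x, x i ∂((Measure.pi fun _ : Fin n => gaussianReal 0 1).map (linEquiv T)) = 0) ∧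
      ∀ i j, ∫ x, x i * x j ∂((Measure.pi fun _ : Fin n => gaussianReal 0 1).map (linEquiv T)) =
        S i j := by
  obtain ⟨M, hM⟩ : ∃ M : Matrix (Fin n) (Fin n) ℝ, M * M.transpose = S := by
    refine ⟨CFC.sqrt S, ?_⟩
    have h := (Matrix.nonneg_iff_posSemidef.1 (CFC.sqrt_nonneg S)).isHermitian
    rw [Matrix.IsHermitian, Matrix.conjTranspose_eq_transpose_of_trivial] at h
    rw [h, CFC.sqrt_mul_sqrt_self S hS.posSemidef.nonneg]
  have hdet : M.det ^ 2 = S.det := by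
    rw [← hM, Matrix.det_mul, Matrix.det_transpose, sq]
  have hM0 : M.det ≠ 0 := by
    intro h0
    have := hS.det_pos
    rw [← hdet, h0] at this
    simp at this
  have hTdet : LinearMap.det (Matrix.toLin' M) ≠ 0 := by rwa [LinearMap.det_toLin']
  let T := LinearMap.equivOfDetNeZero (Matrix.toLin' M) hTdet
  have hT : ∀ x i, T x i = ∑ k, M i k * x k := fun x i => rfl
  have hT' : (T : (Fin n → ℝ) →ₗ[ℝ] (Fin n → ℝ)) = Matrix.toLin' M := by ext; rfl
  have hi : ∀ k, Integrable (fun x : Fin n → ℝ => x k)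
      (Measure.pi fun _ : Fin n => gaussianReal 0 1) := fun k =>
    (memLp_eval_pi_gaussianReal k).integrable one_le_two
  have hij : ∀ k l, Integrable (fun x : Fin n → ℝ => x k * x l)
      (Measure.pi fun _ : Fin n => gaussianReal 0 1) := fun k l =>
    (memLp_eval_pi_gaussianReal k).integrable_mul (memLp_eval_pi_gaussianReal l)
  refine ⟨T, by rw [hT', LinearMap.det_toLin', hdet], fun i => ?_, fun i j => ?_⟩
  · rw [integral_map_equiv]
    simp only [linEquiv_apply, hT]
    rw [integral_finsetSum _ fun k _ => (hi k).const_mul _]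
    simp [integral_const_mul, integral_eval_pi_gaussianReal]
  · rw [integral_map_equiv]
    simp only [linEquiv_apply, hT, Finset.sum_mul_sum]
    have hx : ∀ k l, Integrable (fun x : Fin n → ℝ => M i k * x k * (M j l * x l))
        (Measure.pi fun _ : Fin n => gaussianReal 0 1) := fun k l => by
      refine ((hij k l).const_mul (M i k * M j l)).congr (Eventually.of_forall fun x => ?_)
      ring
    rw [integral_finsetSum _ fun k _ => integrable_finsetSum _ fun l _ => hx k l, ← hM,
      Matrix.mul_apply]
    refine Finset.sum_congr rfl fun k _ => ?_
    rw [integral_finsetSum _ fun l _ => hx k l]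
    have : ∀ l, ∫ x : Fin n → ℝ, M i k * x k * (M j l * x l)
        ∂(Measure.pi fun _ : Fin n => gaussianReal 0 1) =
        M i k * M j l * (1 : Matrix (Fin n) (Fin n) ℝ) k l := by
      intro l
      rw [← integral_eval_mul_eval_pi_gaussianReal, ← integral_const_mul]
      congr 1
      ext x
      ring
    simp [this, Matrix.one_apply]

lemma exists_eq_map_linEquiv {S : Matrix (Fin n) (Fin n) ℝ} (hS : S.PosDef)
    (μ : Measure (Fin n → ℝ)) [IsGaussian μ] (h1 : ∀ i, ∫ x, x i ∂μ = 0)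
    (h2 : ∀ i j, ∫ x, x i * x j ∂μ = S i j) :
    ∃ T : (Fin n → ℝ) ≃ₗ[ℝ] (Fin n → ℝ),
      LinearMap.det (T : (Fin n → ℝ) →ₗ[ℝ] (Fin n → ℝ)) ^ 2 = S.det ∧
      μ = (Measure.pi fun _ : Fin n => gaussianReal 0 1).map (linEquiv T) := by
  obtain ⟨T, hT, hT1, hT2⟩ := exists_map_linEquiv_moments hS
  have := isGaussian_map_linEquiv T (Measure.pi fun _ : Fin n => gaussianReal 0 1)
  exact ⟨T, hT, IsGaussian.ext_of_moments (fun i => (h1 i).trans (hT1 i).symm)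
    fun i j => (h2 i j).trans (hT2 i j).symm⟩

lemma gaussianDensity_measurable :
    Measurable fun x : Fin n → ℝ => ENNReal.ofReal (∏ i, gaussianPDFReal 0 1 (x i)) :=
  (Finset.measurable_fun_prod _ fun i _ =>
    (measurable_gaussianPDFReal 0 1).comp (measurable_pi_apply i)).ennreal_ofReal

lemma absolutelyContinuous_pi_gaussianReal :
    Measure.pi (fun _ : Fin n => gaussianReal 0 1) ≪ volume := by
  rw [pi_gaussianReal_eq_withDensity]
  exact withDensity_absolutelyContinuous _ _

/-- Pulled back to the standard Gaussian, the negative log-density is `log |det T|` plus terms `½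
log 2π + x_i² / 2` of mean `½ log 2π + ½`, and `log |det T| = ½ log det S`. -/
lemma shannonEntropy_gaussian {S : Matrix (Fin n) (Fin n) ℝ} (hS : S.PosDef)
    (μ : Measure (Fin n → ℝ)) [IsGaussian μ] (h1 : ∀ i, ∫ x, x i ∂μ = 0)
    (h2 : ∀ i j, ∫ x, x i * x j ∂μ = S i j) :
    μ ≪ volume ∧ ShannonEntropyExists (μ.rnDeriv volume) ∧
      shannonEntropy (μ.rnDeriv volume) =
        ((n * (1 / 2 * Real.log (2 * Real.pi) + 1 / 2) + 1 / 2 * Real.log S.det : ℝ) : EReal) := by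
  obtain ⟨T, hT, hμ⟩ := exists_eq_map_linEquiv hS μ h1 h2
  set G := Measure.pi fun _ : Fin n => gaussianReal 0 1 with hG
  set d := LinearMap.det (T : (Fin n → ℝ) →ₗ[ℝ] (Fin n → ℝ)) with hd
  have hd0 : 0 < |d| := abs_pos.2 (det_linEquiv_ne_zero T)
  have hac : μ ≪ volume := by
    rw [hμ]
    exact absolutelyContinuous_map_linEquiv T absolutelyContinuous_pi_gaussianReal
  set f : (Fin n → ℝ) → ℝ≥0∞ := fun x => ENNReal.ofReal |d⁻¹| *
    ENNReal.ofReal (∏ i, gaussianPDFReal 0 1 (T.symm x i)) with hf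
  have hfm : Measurable f :=
    (gaussianDensity_measurable.comp (linEquiv T).symm.measurable).const_mul _
  have hμf : μ = volume.withDensity f := by
    rw [hμ, hG, pi_gaussianReal_eq_withDensity,
      map_linEquiv_withDensity T gaussianDensity_measurable]
  have hllr : llr μ volume =ᵐ[μ] fun x =>
      -Real.log |d| - ∑ i, (1 / 2 * Real.log (2 * Real.pi) + T.symm x i ^ 2 / 2) := by
    have h := Measure.rnDeriv_withDensity volume hfm
    rw [← hμf] at h
    filter_upwards [hac.ae_le h] with x hx
    have hpos : ∀ i ∈ Finset.univ, gaussianPDFReal 0 1 (T.symm x i) ≠ 0 := fun i _ =>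
      (gaussianPDFReal_pos 0 1 _ one_ne_zero).ne'
    have hprod := Finset.prod_ne_zero_iff.2 hpos
    have hprod0 : 0 ≤ ∏ i, gaussianPDFReal 0 1 (T.symm x i) :=
      Finset.prod_nonneg fun i _ => gaussianPDFReal_nonneg _ _ _
    rw [llr, hx, hf, ENNReal.toReal_mul, ENNReal.toReal_ofReal (abs_nonneg _),
      ENNReal.toReal_ofReal hprod0, abs_inv, Real.log_mul (inv_ne_zero hd0.ne') hprod,
      Real.log_inv, Real.log_prod hpos]
    simp only [log_gaussianPDFReal one_ne_zero, NNReal.coe_one, mul_one]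
    rw [sub_eq_add_neg, ← Finset.sum_neg_distrib]
    congr 1
    refine Finset.sum_congr rfl fun i _ => by ring
  have hsq : ∀ i, Integrable (fun x : Fin n → ℝ => x i ^ 2) G := fun i =>
    (memLp_eval_pi_gaussianReal i).integrable_sq
  have hterm : ∀ i, Integrable
      (fun x : Fin n → ℝ => 1 / 2 * Real.log (2 * Real.pi) + x i ^ 2 / 2) G := fun i =>
    (integrable_const _).add ((hsq i).div_const _)
  have hsum : Integrable (fun x : Fin n → ℝ =>
      -Real.log |d| - ∑ i, (1 / 2 * Real.log (2 * Real.pi) + x i ^ 2 / 2)) G :=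
    (integrable_const _).sub (integrable_finsetSum _ fun i _ => hterm i)
  have hint : Integrable (llr μ volume) μ := by
    rw [integrable_congr hllr, hμ, integrable_map_equiv]
    refine hsum.congr (Eventually.of_forall fun x => ?_)
    simp
  have hval : ∫ x, llr μ volume x ∂μ =
      -Real.log |d| - n * (1 / 2 * Real.log (2 * Real.pi) + 1 / 2) := by
    rw [integral_congr_ae hllr, hμ, integral_map_equiv]
    simp only [linEquiv_apply, LinearEquiv.symm_apply_apply]
    rw [integral_sub (integrable_const _) (integrable_finsetSum _ fun i _ => hterm i),
      integral_finsetSum _ fun i _ => hterm i]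
    have hone : ∀ i : Fin n, ∫ x, (1 / 2 * Real.log (2 * Real.pi) + x i ^ 2 / 2) ∂G =
        1 / 2 * Real.log (2 * Real.pi) + 1 / 2 := by
      intro i
      rw [integral_add (integrable_const _) ((hsq i).div_const _), integral_div]
      have := integral_eval_mul_eval_pi_gaussianReal i i
      simp only [← sq, Matrix.one_apply_eq] at this
      rw [this]
      simp
    simp only [hone]
    simp
    ring
  have := shannonEntropy_rnDeriv μ hac hint
  refine ⟨hac, this.1, this.2.trans ?_⟩
  rw [hval, ← hT, ← sq_abs, Real.log_pow]
  congr 1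
  push_cast
  ring

end GaussianEntropy

/-! ### Limits of normalized affine sequences in `EReal` -/

section Rates

lemma tendsto_inv_mul_linear {F : ℕ → EReal} {c D : ℝ} {b : ℕ → ℝ}
    (hF : ∀ᶠ N : ℕ in atTop, F N = ((c * N + b N : ℝ) : EReal)) (hb : ∀ N, |b N| ≤ D) :
    Tendsto (fun N : ℕ => (((N : ℝ)⁻¹ : ℝ) : EReal) * F N) atTop (𝓝 (c : EReal)) := by
  have h0 : Tendsto (fun N : ℕ => (N : ℝ)⁻¹ * b N) atTop (𝓝 0) := by
    have h1 : Tendsto (fun N : ℕ => (N : ℝ)⁻¹ * D) atTop (𝓝 0) := by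
      simpa using (tendsto_inv_atTop_nhds_zero_nat (𝕜 := ℝ)).mul_const D
    refine squeeze_zero_norm (fun N => ?_) h1
    rw [norm_mul, Real.norm_eq_abs, Real.norm_eq_abs, abs_of_nonneg (by positivity)]
    exact mul_le_mul_of_nonneg_left (hb N) (by positivity)
  have h2 : Tendsto (fun N : ℕ => c + (N : ℝ)⁻¹ * b N) atTop (𝓝 c) := by
    simpa using h0.const_add c
  refine ((continuous_coe_real_ereal.tendsto c).comp h2).congr' ?_
  filter_upwards [hF, eventually_gt_atTop 0] with N hN hN0
  rw [hN, ← EReal.coe_mul, Function.comp_apply]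
  have : (N : ℝ) ≠ 0 := by positivity
  congr 1
  field_simp

lemma le_of_tendsto_inv_mul {F : ℕ → EReal} {c d : ℝ} {r : EReal}
    (hF : ∀ᶠ N : ℕ in atTop, F N ≤ ((c * N + d : ℝ) : EReal))
    (h : Tendsto (fun N : ℕ => (((N : ℝ)⁻¹ : ℝ) : EReal) * F N) atTop (𝓝 r)) :
    r ≤ (c : EReal) := by
  refine le_of_tendsto_of_tendsto h (tendsto_inv_mul_linear (F := fun N => ((c * N + d : ℝ) : EReal))
    (b := fun _ => d) (Eventually.of_forall fun _ => rfl) fun _ => le_rfl) ?_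
  filter_upwards [hF] with N hN
  exact mul_le_mul_of_nonneg_left hN (EReal.coe_nonneg.2 (by positivity))

end Rates

/-! ### Covariances and Shannon rate of Gauss–Markov processes -/

section GaussMarkov

/-- Concatenation of tuples as a continuous linear map. -/
def appendCLM (m n : ℕ) : (Fin m → ℝ) × (Fin n → ℝ) →L[ℝ] (Fin (m + n) → ℝ) :=
  ContinuousLinearMap.pi fun i => Fin.addCases
    (fun l => (ContinuousLinearMap.proj (R := ℝ) (φ := fun _ : Fin m => ℝ) l).comp
      (ContinuousLinearMap.fst ℝ _ _))
    (fun l => (ContinuousLinearMap.proj (R := ℝ) (φ := fun _ : Fin n => ℝ) l).comp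
      (ContinuousLinearMap.snd ℝ _ _)) i

lemma appendCLM_apply (m n : ℕ) (x : (Fin m → ℝ) × (Fin n → ℝ)) :
    appendCLM m n x = Fin.append x.1 x.2 := by
  ext i
  induction i using Fin.addCases <;> simp [appendCLM]

variable {Ω : Type*} [MeasurableSpace Ω] {P : Measure Ω} {γ : ℕ → ℝ} {p : ℕ} {a : Fin p → ℝ}

lemma integral_linearImage_mul {n : ℕ} {U : Ω → Fin n → ℝ} (hU : ∀ i, MemLp (fun ω => U ω i) 2 P)
    {S : Matrix (Fin n) (Fin n) ℝ} (hS : ∀ i j, ∫ ω, U ω i * U ω j ∂P = S i j)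
    (A : Matrix (Fin n) (Fin n) ℝ) (i j : Fin n) :
    ∫ ω, A.mulVec (U ω) i * A.mulVec (U ω) j ∂P = (A * S * A.transpose) i j := by
  have h := fun i => toLp_linearCombination hU (A i)
  have h1 : ∀ ω i, A.mulVec (U ω) i = ∑ k, A i k * U ω k := fun _ _ => rfl
  simp only [h1]
  rw [← inner_toLp (h i).1 (h j).1, (h i).2, (h j).2, sum_inner]
  simp only [inner_sum, inner_smul_left, inner_smul_right, inner_toLp, hS]
  simp only [Matrix.mul_apply, Matrix.transpose_apply, Finset.sum_mul, RCLike.conj_to_real]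
  rw [Finset.sum_comm]
  exact Finset.sum_congr rfl fun k _ => Finset.sum_congr rfl fun l _ => by ring

/-- The second-moment matrix of `(X₁, …, X_p, Z₁, …, Z_n)` for white noise `Z`. -/
def innovCov (γ : ℕ → ℝ) (p : ℕ) (v : ℝ) (n : ℕ) : Matrix (Fin (p + n)) (Fin (p + n)) ℝ :=
  (Matrix.fromBlocks (toeplitz γ p) 0 0 (v • (1 : Matrix (Fin n) (Fin n) ℝ))).submatrix
    finSumFinEquiv.symm finSumFinEquiv.symm

lemma det_innovCov (v : ℝ) (n : ℕ) :
    (innovCov γ p v n).det = (toeplitz γ p).det * v ^ n := by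
  rw [innovCov, Matrix.det_submatrix_equiv_self, Matrix.det_fromBlocks_zero₂₁]
  simp

lemma innovCov_posDef (h : (toeplitz γ p).PosDef) {v : ℝ} (hv : 0 < v) (n : ℕ) :
    (innovCov γ p v n).PosDef := by
  have h1 : (v • (1 : Matrix (Fin n) (Fin n) ℝ)).PosDef := Matrix.PosDef.one.smul hv
  have : Invertible (toeplitz γ p) := h.isUnit.invertible
  have h2 := (Matrix.PosDef.fromBlocks₁₁ (A := toeplitz γ p) 0
    (v • (1 : Matrix (Fin n) (Fin n) ℝ)) h).2 (by simpa using h1.posSemidef)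
  rw [Matrix.conjTranspose_zero] at h2
  have h3 : (innovCov γ p v n).PosSemidef := h2.submatrix _
  -- The Schur complement criterion gave only semidefiniteness; the nonzero determinant upgrades it.
  rw [h3.posDef_iff_isUnit, Matrix.isUnit_iff_isUnit_det, det_innovCov]
  exact (mul_pos h.det_pos (pow_pos hv n)).ne'.isUnit

/-- Since `X` starts at `Y p`, the innovation coordinates of its block are `Y p, …, Y (2p - 1)`,
with moments from `hX`, followed by the noises from `Z p` on, which are orthogonal to that past. -/
lemma integral_autoregression_mul {v : ℝ} {Y Z : ℕ → Ω → ℝ}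
    (h : IsAutoregression γ p a v P Y Z) (hX : SatisfiesBurg γ p P fun i => Y (i + p)) (n : ℕ)
    (i j : Fin (p + n)) :
    ∫ ω, innovMap a (p + n) (initialBlock (fun i => Y (i + p)) (p + n) ω) i *
      innovMap a (p + n) (initialBlock (fun i => Y (i + p)) (p + n) ω) j ∂P =
      innovCov γ p v n i j := by
  have hinit : ∀ (l : Fin p) (ω : Ω), innovMap a (p + n)
      (initialBlock (fun i => Y (i + p)) (p + n) ω) (Fin.castAdd n l) = Y (l + p) ω := by
    intro l ω
    rw [innovMap_apply_of_lt _ _ (by simp)]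
    rfl
  have hnoise : ∀ (i : Fin n) (ω : Ω), innovMap a (p + n)
      (initialBlock (fun i => Y (i + p)) (p + n) ω) (Fin.natAdd p i) = Z (p + i) ω := by
    intro i ω
    rw [innovMap_apply_of_le _ _ (by simp)]
    simp only [initialBlock, Fin.val_natAdd]
    rw [h.recursion (p + i), sub_eq_iff_eq_add, add_comm]
    congr 1
    refine Finset.sum_congr rfl fun k _ => ?_
    rw [show p + (i : ℕ) - (k + 1) + p = p + i + p - (k + 1) by omega]
  have hzero : ∀ (l : Fin p) (i : Fin n), ∫ ω, Z (p + i) ω * Y (l + p) ω ∂P = 0 := fun l i =>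
    h.noise_mul_past _ _ (by omega)
  induction i using Fin.addCases with
  | left i =>
    induction j using Fin.addCases with
    | left j =>
      simp only [hinit, innovCov, Matrix.submatrix_apply, finSumFinEquiv_symm_apply_castAdd,
        Matrix.fromBlocks_apply₁₁]
      rcases le_total (i : ℕ) j with hij | hij
      · have := hX.moment i (j - i) (by omega)
        rw [show (i : ℕ) + (j - i) = j by omega] at this
        rw [this]
        simp only [toeplitz, Matrix.of_apply]
        congr 1; omega
      · have := hX.moment j (i - j) (by omega)
        rw [show (j : ℕ) + (i - j) = i by omega] at this
        simp only [mul_comm (Y (i + p) _)]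
        rw [this]
        simp only [toeplitz, Matrix.of_apply]
        congr 1; omega
    | right j =>
      simp only [hinit, hnoise, innovCov, Matrix.submatrix_apply,
        finSumFinEquiv_symm_apply_castAdd, finSumFinEquiv_symm_apply_natAdd,
        Matrix.fromBlocks_apply₁₂, Matrix.zero_apply, mul_comm (Y (i + p) _), hzero]
  | right i =>
    induction j using Fin.addCases with
    | left j =>
      simp only [hinit, hnoise, innovCov, Matrix.submatrix_apply,
        finSumFinEquiv_symm_apply_castAdd, finSumFinEquiv_symm_apply_natAdd,
        Matrix.fromBlocks_apply₂₁, Matrix.zero_apply, hzero]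
    | right j =>
      simp only [hnoise, innovCov, Matrix.submatrix_apply, finSumFinEquiv_symm_apply_natAdd,
        Matrix.fromBlocks_apply₂₂, Matrix.smul_apply, smul_eq_mul]
      rcases lt_trichotomy j i with hij | rfl | hij
      · rw [h.noise_mul_noise _ _ (by omega), Matrix.one_apply_ne hij.ne', mul_zero]
      · rw [h.noise_sq, Matrix.one_apply_eq, mul_one]
      · simp only [mul_comm (Z (p + i) _)]
        rw [h.noise_mul_noise _ _ (by omega), Matrix.one_apply_ne hij.ne, mul_zero]

/-- Undoing the innovation map is a congruence by a matrix of determinant one, so positivity and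
determinant are inherited from `innovCov`. -/
lemma exists_blockCov {v : ℝ} {Y Z : ℕ → Ω → ℝ} (hT : (toeplitz γ p).PosDef) (hv : 0 < v)
    (h : IsAutoregression γ p a v P Y Z) (hX : SatisfiesBurg γ p P fun i => Y (i + p)) (n : ℕ) :
    ∃ S : Matrix (Fin (p + n)) (Fin (p + n)) ℝ, S.PosDef ∧
      S.det = (toeplitz γ p).det * v ^ n ∧
      ∀ i j : Fin (p + n), ∫ ω, Y (i + p) ω * Y (j + p) ω ∂P = S i j := by
  set L := innovEquiv a (p + n) with hL
  set A := LinearMap.toMatrix' (L.symm : (Fin (p + n) → ℝ) →ₗ[ℝ] (Fin (p + n) → ℝ)) with hA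
  have hAdet : A.det = 1 := by
    have := LinearEquiv.det_symm_mul_det L
    rw [hL, det_innovEquiv, mul_one] at this
    rw [hA, LinearMap.det_toMatrix', this]
  have hpd := innovCov_posDef hT hv n
  refine ⟨A * innovCov γ p v n * A.transpose, ?_, ?_, fun i j => ?_⟩
  · rw [← Matrix.conjTranspose_eq_transpose_of_trivial]
    refine hpd.mul_mul_conjTranspose_same (Matrix.vecMul_injective_of_isUnit ?_)
    rw [Matrix.isUnit_iff_isUnit_det, hAdet]
    exact isUnit_one
  · rw [Matrix.det_mul, Matrix.det_mul, Matrix.det_transpose, hAdet, det_innovCov, one_mul, mul_one]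
  · have hm : ∀ i, MemLp (fun ω => innovMap a (p + n)
        (initialBlock (fun i => Y (i + p)) (p + n) ω) i) 2 P := by
      intro i
      have := (toLp_linearCombination (fun j : Fin (p + n) => hX.memLp j)
        (LinearMap.toMatrix' (innovMap a (p + n)) i)).1
      refine this.ae_eq (Eventually.of_forall fun ω => ?_)
      exact congrFun (LinearMap.toMatrix'_mulVec (innovMap a (p + n))
        (initialBlock (fun i => Y (i + p)) (p + n) ω)) i
    rw [← integral_linearImage_mul hm (integral_autoregression_mul h hX n) A i j]
    have hAx : ∀ x, A.mulVec (innovMap a (p + n) x) = x := by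
      intro x
      rw [hA, LinearMap.toMatrix'_mulVec]
      exact L.symm_apply_apply x
    simp only [hAx]
    rfl

namespace IsGaussMarkov

variable {v : ℝ≥0} {X : ℕ → Ω → ℝ}

lemma hasGaussianLaw_eval {n : ℕ} {Y : ℕ → Ω → ℝ} (h : HasGaussianLaw (initialBlock Y n) P)
    (l : Fin n) : HasGaussianLaw (Y l) P :=
  h.map (ContinuousLinearMap.proj (R := ℝ) (φ := fun _ : Fin n => ℝ) l)

lemma exists_isAutoregression [IsProbabilityMeasure P] (h : IsGaussMarkov γ p a v P X) :
    ∃ Y Z : ℕ → Ω → ℝ, IsAutoregression γ p a v P Y Z ∧ (X = fun i => Y (i + p)) ∧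
      ∀ n, HasGaussianLaw (initialBlock X n) P ∧ ∀ i, ∫ ω, X i ω ∂P = 0 := by
  obtain ⟨Y, Z, hYm, hZm, hYg, hY0, hYc, hZ, hZi, hYZ, hrec, hX⟩ := h
  have hZ0 : ∀ i, ∫ ω, Z i ω ∂P = 0 := fun i => by
    rw [(hZ i).integral_eq]; exact integral_id_gaussianReal
  have hZL : ∀ i, MemLp (Z i) 2 P := fun i => (hZ i).hasGaussianLaw.memLp_two
  have hAR : IsAutoregression γ p a v P Y Z := {
    measurable := hYm
    measurable_noise := hZm
    memLp_init := fun l hl => (hasGaussianLaw_eval hYg ⟨l, hl⟩).memLp_two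
    memLp_noise := hZL
    recursion := hrec
    noise_mul_noise := fun i j hij => by
      rw [(hZi.indepFun hij.ne').integral_fun_mul_eq_mul_integral
        (hZm i).aestronglyMeasurable (hZm j).aestronglyMeasurable, hZ0, zero_mul]
    noise_sq := fun i => by
      have h1 := (hZ i).variance_eq
      rw [variance_eq_sub (hZL i), hZ0, variance_id_gaussianReal] at h1
      simpa [sq] using h1
    noise_mul_init := fun i l hl => by
      have h1 : IndepFun (Y l) (Z i) P := hYZ.comp (φ := fun x : Fin p → ℝ => x ⟨l, hl⟩)
        (ψ := fun z : ℕ → ℝ => z i) (measurable_pi_apply _) (measurable_pi_apply _)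
      rw [h1.symm.integral_fun_mul_eq_mul_integral
        (hZm i).aestronglyMeasurable (hYm l).aestronglyMeasurable, hZ0, zero_mul]
    init_mul_init := fun l hl m hm => hYc ⟨l, hl⟩ ⟨m, hm⟩ }
  refine ⟨Y, Z, hAR, funext hX, fun n => ⟨?_, fun i => ?_⟩⟩
  · have h1 : HasGaussianLaw (fun ω (i : Fin n) => Z i ω) P :=
      (hZi.precomp (g := fun i : Fin n => (i : ℕ)) Fin.val_injective).hasGaussianLaw
        fun i => (hZ i).hasGaussianLaw
    have h2 : IndepFun (initialBlock Y p) (fun ω (i : Fin n) => Z i ω) P :=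
      hYZ.comp (φ := id) (ψ := fun (z : ℕ → ℝ) (i : Fin n) => z i) measurable_id
        (measurable_pi_lambda _ fun i => measurable_pi_apply _)
    have h3 := (h2.hasGaussianLaw hYg h1).map (appendCLM p n)
    have h4 := h3.map (innovEquiv a (p + n)).symm.toContinuousLinearEquiv.toContinuousLinearMap
    -- The vector in `h4` is the block `Y 0, …, Y (p + n - 1)`; dropping its first `p` entries
    -- leaves the block of `X`.
    have h5 := h4.map (ContinuousLinearMap.pi fun i : Fin n =>
      ContinuousLinearMap.proj (R := ℝ) (φ := fun _ : Fin (p + n) => ℝ) (Fin.natAdd p i))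
    refine h5.congr (Eventually.of_forall fun ω => funext fun i => Eq.symm ?_)
    have h6 := innovMap_recursion (y := fun i => Y i ω) (z := fun i => Z i ω)
      (fun i => hrec i ω) n
    have h7 := congrArg (innovEquiv a (p + n)).symm h6
    rw [← innovEquiv_apply, LinearEquiv.symm_apply_apply] at h7
    have h8 := congrFun h7 (Fin.natAdd p i)
    rw [initialBlock, hX]
    simp only [Fin.val_natAdd] at h8
    rw [add_comm, h8]
    simp [appendCLM_apply]
    rfl
  · have hYall : ∀ j, ∫ ω, Y j ω ∂P = 0 := by
      intro j
      induction j using Nat.strong_induction_on with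
      | _ j ih =>
        rcases lt_or_ge j p with hj | hj
        · exact hY0 ⟨j, hj⟩
        · obtain ⟨m, rfl⟩ := Nat.exists_eq_add_of_le' hj
          have hi : ∀ k : Fin p, Integrable (fun ω => a k * Y (m + p - (k + 1)) ω) P := fun k =>
            ((hAR.memLp _).integrable one_le_two).const_mul _
          simp only [hrec]
          rw [integral_add (integrable_finsetSum _ fun k _ => hi k)
            ((hZL m).integrable one_le_two), integral_finsetSum _ fun k _ => hi k, hZ0, add_zero]
          refine Finset.sum_eq_zero fun k _ => ?_
          rw [integral_const_mul, ih _ (by omega), mul_zero]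
    rw [hX]
    exact hYall _

lemma yuleWalker [IsProbabilityMeasure P] (h : IsGaussMarkov γ p a v P X)
    (hX : SatisfiesBurg γ p P X) : YuleWalker γ p a v := by
  obtain ⟨Y, Z, hAR, rfl, -⟩ := h.exists_isAutoregression
  exact hAR.yuleWalker hX

lemma block_entropy [IsProbabilityMeasure P] (h : IsGaussMarkov γ p a v P X)
    (hX : SatisfiesBurg γ p P X) {n : ℕ} {S : Matrix (Fin n) (Fin n) ℝ} (hS : S.PosDef)
    (h2 : ∀ i j : Fin n, ∫ ω, X i ω * X j ω ∂P = S i j) :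
    HasPDF (initialBlock X n) P volume ∧
      ShannonEntropyExists (pdf (initialBlock X n) P volume) ∧
      shannonEntropy (pdf (initialBlock X n) P volume) =
        ((n * (1 / 2 * Real.log (2 * Real.pi) + 1 / 2) + 1 / 2 * Real.log S.det : ℝ) : EReal) := by
  obtain ⟨-, -, -, -, hg⟩ := h.exists_isAutoregression
  have hm := hX.measurable_initialBlock n
  have := (hg n).1.isGaussian_map
  have h1 : ∀ i : Fin n, ∫ x, x i ∂(P.map (initialBlock X n)) = 0 := by
    intro i
    rw [integral_map hm.aemeasurable (measurable_pi_apply i).aestronglyMeasurable]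
    exact (hg n).2 i
  have h3 : ∀ i j : Fin n, ∫ x, x i * x j ∂(P.map (initialBlock X n)) = S i j := by
    intro i j
    have hij : Measurable fun x : Fin n → ℝ => x i * x j :=
      (measurable_pi_apply i).mul (measurable_pi_apply j)
    rw [integral_map hm.aemeasurable hij.aestronglyMeasurable]
    exact h2 i j
  have key := shannonEntropy_gaussian hS (P.map (initialBlock X n)) h1 h3
  exact ⟨⟨hm.aemeasurable, inferInstance, key.1⟩, key.2⟩

lemma hasShannonRate [IsProbabilityMeasure P] (h : IsGaussMarkov γ p a v P X)
    (hX : SatisfiesBurg γ p P X) (hγ : (toeplitz γ (p + 1)).PosDef) :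
    HasShannonRate P X
      (((1 / 2) * Real.log (2 * Real.pi * Real.exp 1 * (v : ℝ)) : ℝ) : EReal) := by
  have hv : (0 : ℝ) < v := (h.yuleWalker hX).pos hγ
  have hT := toeplitz_castLE_posDef hγ (Nat.le_succ p)
  obtain ⟨Y, Z, hAR, hXY, -⟩ := h.exists_isAutoregression
  have hcov : ∀ n, ∃ S : Matrix (Fin (p + n)) (Fin (p + n)) ℝ, S.PosDef ∧
      S.det = (toeplitz γ p).det * (v : ℝ) ^ n ∧
      ∀ i j : Fin (p + n), ∫ ω, X i ω * X j ω ∂P = S i j := by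
    subst hXY
    exact exists_blockCov hT hv hAR hX
  constructor
  · intro n
    obtain ⟨S, hS, -, h2⟩ := hcov n
    -- Every block needs an entropy, also those with `n < p`; its covariance is a principal
    -- submatrix of the one for length `p + n`.
    have hle : n ≤ p + n := Nat.le_add_left n p
    have := h.block_entropy hX (hS.submatrix (Fin.castLE_injective hle))
      fun i j => h2 (Fin.castLE hle i) (Fin.castLE hle j)
    exact ⟨this.1, this.2.1⟩
  · have hlog : Real.log (2 * Real.pi * Real.exp 1 * v) =
        Real.log (2 * Real.pi) + 1 + Real.log v := by
      rw [mul_right_comm, Real.log_mul (by positivity) (by positivity), Real.log_exp,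
        Real.log_mul (by positivity) hv.ne']
      ring
    refine tendsto_inv_mul_linear
      (b := fun _ => 1 / 2 * Real.log (toeplitz γ p).det - p * (1 / 2 * Real.log v)) ?_
      fun _ => le_rfl
    filter_upwards [eventually_ge_atTop p] with N hN
    obtain ⟨n, rfl⟩ := Nat.exists_eq_add_of_le hN
    obtain ⟨S, hS, hdet, h2⟩ := hcov n
    -- The entropy is affine in `N`: `log det S = log det (toeplitz γ p) + n log v` with `n = N -
    -- p`.
    rw [(h.block_entropy hX hS h2).2.2, hdet, Real.log_mul hT.det_pos.ne' (pow_pos hv n).ne',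
      Real.log_pow, hlog]
    congr 1
    push_cast
    ring

end IsGaussMarkov

end GaussMarkov

/-! ### Autoregressions driven by arbitrary white noise -/

section Construction

/-- The path of the autoregressive process with initial values `x` and innovations `z`. -/
def arPath {p : ℕ} (a : Fin p → ℝ) (x : Fin p → ℝ) (z : ℕ → ℝ) (i : ℕ) : ℝ :=
  if h : i < p then x ⟨i, h⟩ else
    (∑ k : Fin p, a k * arPath a x z (i - (k + 1))) + z (i - p)
termination_by i
decreasing_by have := k.2; omega

variable {p : ℕ} (a : Fin p → ℝ)

lemma arPath_of_lt (x : Fin p → ℝ) (z : ℕ → ℝ) (l : Fin p) : arPath a x z l = x l := by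
  rw [arPath]
  simp

lemma arPath_add (x : Fin p → ℝ) (z : ℕ → ℝ) (i : ℕ) :
    arPath a x z (i + p) = (∑ k : Fin p, a k * arPath a x z (i + p - (k + 1))) + z i := by
  rw [arPath]
  simp

lemma measurable_arPath (i : ℕ) :
    Measurable fun w : (Fin p → ℝ) × (ℕ → ℝ) => arPath a w.1 w.2 i := by
  induction i using Nat.strong_induction_on with
  | _ i ih =>
    rcases lt_or_ge i p with hi | hi
    · simp only [fun w : (Fin p → ℝ) × (ℕ → ℝ) => arPath_of_lt a w.1 w.2 ⟨i, hi⟩]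
      exact (measurable_pi_apply _).comp measurable_fst
    · obtain ⟨m, rfl⟩ := Nat.exists_eq_add_of_le' hi
      simp only [arPath_add]
      exact (Finset.measurable_fun_sum _ fun k _ => (ih _ (by omega)).const_mul _).add
        ((measurable_pi_apply m).comp measurable_snd)

/-- Centered white noise of variance `v`. -/
structure IsWhiteNoise {Ω : Type*} [MeasurableSpace Ω] (v : ℝ) (P : Measure Ω)
    (Z : ℕ → Ω → ℝ) : Prop where
  measurable : ∀ i, Measurable (Z i)
  memLp : ∀ i, MemLp (Z i) 2 P
  integral_eq_zero : ∀ i, ∫ ω, Z i ω ∂P = 0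
  integral_mul : ∀ i j, j < i → ∫ ω, Z i ω * Z j ω ∂P = 0
  integral_sq : ∀ i, ∫ ω, Z i ω * Z i ω ∂P = v

lemma gaussianPDFReal_zero_one_le (x : ℝ) : gaussianPDFReal 0 1 x ≤ 1 := by
  rw [gaussianPDFReal]
  refine mul_le_one₀ (inv_le_one_of_one_le₀ ?_) (Real.exp_pos _).le (Real.exp_le_one_iff.2 ?_)
  · rw [Real.one_le_sqrt]
    have := Real.pi_gt_three
    simp only [NNReal.coe_one]
    linarith
  · have := sq_nonneg (x - 0)
    simp only [NNReal.coe_one]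
    linarith

/-- The density is at most `(2π)^(-n/2) ≤ 1`. -/
lemma pi_gaussianReal_le_volume {n : ℕ} :
    (Measure.pi fun _ : Fin n => gaussianReal 0 1) ≤ volume := by
  rw [pi_gaussianReal_eq_withDensity]
  refine le_of_le_of_eq (withDensity_mono (Eventually.of_forall fun x => ?_)) withDensity_one
  rw [Pi.one_apply, ENNReal.ofReal_le_one]
  exact Finset.prod_le_one (fun i _ => gaussianPDFReal_nonneg _ _ _) fun i _ =>
    gaussianPDFReal_zero_one_le _

/-- A bounded density has finite Rényi integrals of every order above one, so the initial vector
adds only a constant to the entropies. -/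
lemma exists_gaussian_init {γ : ℕ → ℝ} (hT : (toeplitz γ p).PosDef) :
    ∃ μ : Measure (Fin p → ℝ), IsGaussian μ ∧ μ ≪ volume ∧
      (∀ α : ℝ, 1 < α → renyiInt α μ ≠ ⊤) ∧ (∀ l, ∫ x, x l ∂μ = 0) ∧
      ∀ l m, ∫ x, x l * x m ∂μ = toeplitz γ p l m := by
  obtain ⟨T, -, h1, h2⟩ := exists_map_linEquiv_moments hT
  refine ⟨(Measure.pi fun _ : Fin p => gaussianReal 0 1).map (linEquiv T),
    isGaussian_map_linEquiv T _,
    absolutelyContinuous_map_linEquiv T absolutelyContinuous_pi_gaussianReal, fun α hα => ?_, h1, h2⟩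
  rw [renyiInt_map_linEquiv T _ absolutelyContinuous_pi_gaussianReal (zero_le_one.trans hα.le)]
  refine ENNReal.mul_ne_top ENNReal.ofReal_ne_top
    (renyiInt_ne_top_of_le_smul ENNReal.one_ne_top ?_ hα)
  rw [one_smul]
  exact pi_gaussianReal_le_volume

/-- The autoregressive process on the product space `ℝᵖ × Ω`. -/
def arProcess {Ω : Type*} (Z : ℕ → Ω → ℝ) (i : ℕ) (w : (Fin p → ℝ) × Ω) : ℝ :=
  arPath a w.1 (fun j => Z j w.2) i

lemma initialBlock_arProcess {Ω : Type*} (Z : ℕ → Ω → ℝ) :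
    initialBlock (arProcess a Z) p = Prod.fst := by
  ext w l
  exact arPath_of_lt a _ _ l

variable {Ω : Type*} [MeasurableSpace Ω] {P : Measure Ω} [IsProbabilityMeasure P] {γ : ℕ → ℝ}
  {v : ℝ} {Z : ℕ → Ω → ℝ} {μ : Measure (Fin p → ℝ)} [IsGaussian μ]

lemma isAutoregression_arProcess (hZ : IsWhiteNoise v P Z) (h1 : ∀ l, ∫ x, x l ∂μ = 0)
    (h2 : ∀ l m, ∫ x, x l * x m ∂μ = toeplitz γ p l m) :
    IsAutoregression γ p a v (μ.prod P) (arProcess a Z) (fun i w => Z i w.2) := by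
  have hμ : ∀ l : Fin p, MemLp (fun x : Fin p → ℝ => x l) 2 μ := fun l =>
    IsGaussian.memLp_dual μ (ContinuousLinearMap.proj l) 2 (by simp)
  have hl : ∀ l (hl : l < p), arProcess a Z l = fun w => w.1 ⟨l, hl⟩ := fun l hl =>
    funext fun w => arPath_of_lt a w.1 _ ⟨l, hl⟩
  have hsnd : ∀ f : Ω → ℝ, ∫ w : (Fin p → ℝ) × Ω, f w.2 ∂(μ.prod P) = ∫ ω, f ω ∂P := fun f => by
    rw [integral_fun_snd]; simp
  have hfst : ∀ f : (Fin p → ℝ) → ℝ,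
      ∫ w : (Fin p → ℝ) × Ω, f w.1 ∂(μ.prod P) = ∫ x, f x ∂μ := fun f => by
    rw [integral_fun_fst]; simp
  exact {
    measurable := fun i => (measurable_arPath a i).comp
      (measurable_fst.prodMk (measurable_pi_lambda _ fun j => (hZ.measurable j).comp measurable_snd))
    measurable_noise := fun i => (hZ.measurable i).comp measurable_snd
    memLp_init := fun l h => by
      rw [hl l h]
      exact (hμ ⟨l, h⟩).comp_measurePreserving measurePreserving_fst
    memLp_noise := fun i => (hZ.memLp i).comp_measurePreserving measurePreserving_snd
    recursion := fun i w => arPath_add a _ _ i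
    noise_mul_noise := fun i j hij =>
      (hsnd fun ω => Z i ω * Z j ω).trans (hZ.integral_mul i j hij)
    noise_sq := fun i => (hsnd fun ω => Z i ω * Z i ω).trans (hZ.integral_sq i)
    noise_mul_init := fun i l h => by
      simp only [hl l h, mul_comm (Z i _)]
      rw [integral_prod_mul (fun x : Fin p → ℝ => x ⟨l, h⟩) (Z i), h1, zero_mul]
    init_mul_init := fun l h m h' => by
      simp only [hl l h, hl m h']
      exact (hfst fun x => x ⟨l, h⟩ * x ⟨m, h'⟩).trans (h2 _ _) }

lemma map_initialBlock_arProcess (hZ : ∀ i, Measurable (Z i)) (n : ℕ) :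
    (μ.prod P).map (initialBlock (arProcess a Z) (p + n)) =
      ((μ.prod (P.map (initialBlock Z n))).map (finAppend p n)).map
        (linEquiv (innovEquiv a (p + n)).symm) := by
  have hm : Measurable (initialBlock Z n) := measurable_pi_lambda _ fun i => hZ i
  have h1 : initialBlock (arProcess a Z) (p + n) =
      (linEquiv (innovEquiv a (p + n)).symm ∘ finAppend p n) ∘ Prod.map id (initialBlock Z n) := by
    ext1 w
    have h2 := innovMap_recursion (a := a) (y := fun i => arProcess a Z i w) (z := fun i => Z i w.2)
      (fun i => arPath_add a _ _ i) n
    have h3 := congrArg (innovEquiv a (p + n)).symm h2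
    rw [← innovEquiv_apply, LinearEquiv.symm_apply_apply] at h3
    refine h3.trans ?_
    simp only [Function.comp_apply, linEquiv_apply, finAppend_apply, Prod.map_fst, Prod.map_snd,
      id_eq]
    congr 2
    ext l
    exact arPath_of_lt a _ _ l
  rw [h1, ← Measure.map_map ((MeasurableEquiv.measurable _).comp (MeasurableEquiv.measurable _))
    (measurable_id.prodMap hm), ← Measure.map_prod_map _ _ measurable_id hm, Measure.map_id,
    Measure.map_map (MeasurableEquiv.measurable _) (MeasurableEquiv.measurable _)]

/-- The path is the image of the independent pair (initial vector, noise) under the inverse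
innovation map, which has determinant one. -/
lemma renyiInt_arProcess (hZ : ∀ i, Measurable (Z i)) (hμ : μ ≪ volume) {n : ℕ}
    (hac : P.map (initialBlock Z n) ≪ volume) :
    (μ.prod P).map (initialBlock (arProcess a Z) (p + n)) ≪ volume ∧
      ∀ α : ℝ, 0 ≤ α → renyiInt α ((μ.prod P).map (initialBlock (arProcess a Z) (p + n))) =
        renyiInt α μ * renyiInt α (P.map (initialBlock Z n)) := by
  have hm : Measurable (initialBlock Z n) := measurable_pi_lambda _ fun i => hZ i
  have := Measure.isProbabilityMeasure_map (μ := P) hm.aemeasurable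
  have h1 := absolutelyContinuous_map_finAppend hμ hac
  rw [map_initialBlock_arProcess a hZ n]
  refine ⟨absolutelyContinuous_map_linEquiv _ h1, fun α hα => ?_⟩
  have : IsFiniteMeasure ((μ.prod (P.map (initialBlock Z n))).map (finAppend p n)) :=
    Measure.isFiniteMeasure_map _ _
  have hdet : LinearMap.det ((innovEquiv a (p + n)).symm :
      (Fin (p + n) → ℝ) →ₗ[ℝ] (Fin (p + n) → ℝ)) = 1 := by
    have := LinearEquiv.det_symm_mul_det (innovEquiv a (p + n))
    rwa [det_innovEquiv, mul_one] at this
  rw [renyiInt_map_linEquiv _ _ h1 hα, renyiInt_finAppend _ _ hα hμ hac, hdet]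
  simp

lemma absolutelyContinuous_map_castAdd {m n : ℕ} {ν : Measure (Fin (m + n) → ℝ)}
    (hν : ν ≪ volume) : ν.map (fun x (i : Fin m) => x (Fin.castAdd n i)) ≪ volume := by
  have hmeas : Measurable fun (x : Fin (m + n) → ℝ) (i : Fin m) => x (Fin.castAdd n i) :=
    measurable_pi_lambda _ fun i => measurable_pi_apply _
  refine (hν.map hmeas).trans ?_
  rw [← volume_map_finAppend m n, Measure.map_map hmeas (MeasurableEquiv.measurable _)]
  have : (fun (x : Fin (m + n) → ℝ) (i : Fin m) => x (Fin.castAdd n i)) ∘ finAppend m n =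
      Prod.fst := by
    ext x i
    simp
  rw [this]
  exact Measure.quasiMeasurePreserving_fst.absolutelyContinuous

/-- Supplies densities for blocks shorter than `p`, which `renyiInt_arProcess` does not cover. -/
lemma absolutelyContinuous_map_initialBlock {Ω : Type*} [MeasurableSpace Ω] {P : Measure Ω}
    {X : ℕ → Ω → ℝ} (hX : ∀ i, Measurable (X i)) {m n : ℕ}
    (hmn : m ≤ n) (h : P.map (initialBlock X n) ≪ volume) :
    P.map (initialBlock X m) ≪ volume := by
  obtain ⟨k, rfl⟩ := Nat.exists_eq_add_of_le hmn
  have := absolutelyContinuous_map_castAdd h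
  have h1 : Measurable (initialBlock X (m + k)) := measurable_pi_lambda _ fun i => hX i
  have h2 : Measurable fun (x : Fin (m + k) → ℝ) (i : Fin m) => x (Fin.castAdd k i) :=
    measurable_pi_lambda _ fun i => measurable_pi_apply _
  rwa [Measure.map_map h2 h1] at this

end Construction

/-! ### Existence of the Gauss–Markov process -/

section GaussMarkovExistence

lemma exists_isGaussMarkov (p : ℕ) (γ : ℕ → ℝ) (hγ : (toeplitz γ (p + 1)).PosDef) :
    ∃ (Ω : Type u) (_ : MeasurableSpace Ω) (P : Measure Ω) (X : ℕ → Ω → ℝ)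
      (a : Fin p → ℝ) (v : ℝ≥0),
      IsProbabilityMeasure P ∧ IsGaussMarkov γ p a v P X ∧ SatisfiesBurg γ p P X := by
  obtain ⟨a, v, hyw⟩ := exists_yuleWalker hγ
  have hv := hyw.pos hγ
  lift v to ℝ≥0 using hv.le
  obtain ⟨μ, hμg, -, -, h1, h2⟩ := exists_gaussian_init (toeplitz_castLE_posDef hγ (Nat.le_succ p))
  -- `ULift` places the sample space in universe `u`.
  obtain ⟨Ω, _, P, U, hUm, hUl, hUi, hP⟩ := exists_iid (ULift.{u} ℕ) (gaussianReal 0 v)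
  have hZi : iIndepFun (fun i => U (ULift.up i)) P := hUi.precomp ULift.up_injective
  have hm0 : ∀ i, ∫ ω, U i ω ∂P = 0 := fun i => by
    rw [(hUl i).integral_eq]; exact integral_id_gaussianReal
  have hL : ∀ i, MemLp (U i) 2 P := fun i => (hUl i).hasGaussianLaw.memLp_two
  have hZ : IsWhiteNoise (v : ℝ) P (fun i => U (ULift.up i)) := {
    measurable := fun i => hUm _
    memLp := fun i => hL _
    integral_eq_zero := fun i => hm0 _
    integral_mul := fun i j hij => by
      rw [(hZi.indepFun hij.ne').integral_fun_mul_eq_mul_integral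
        (hUm _).aestronglyMeasurable (hUm _).aestronglyMeasurable, hm0, zero_mul]
    integral_sq := fun i => by
      have h1 := (hUl (ULift.up i)).variance_eq
      rw [variance_eq_sub (hL _), hm0, variance_id_gaussianReal] at h1
      simpa [sq] using h1 }
  have hAR := isAutoregression_arProcess a hZ h1 h2
  refine ⟨(Fin p → ℝ) × Ω, inferInstance, μ.prod P,
    fun i => arProcess a (fun i => U (ULift.up i)) (i + p), a, v, inferInstance,
    ⟨arProcess a fun i => U (ULift.up i), fun i w => U (ULift.up i) w.2, hAR.measurable,
      hAR.measurable_noise, ?_, fun l => ?_, fun l m => hAR.init_mul_init l l.2 m m.2,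
      fun i => (hUl _).comp measurePreserving_snd.hasLaw, ?_, ?_, hAR.recursion, fun _ => rfl⟩,
    (hAR.satisfiesBurg hyw).shift p⟩
  · rw [initialBlock_arProcess]
    exact measurePreserving_fst.hasLaw.hasGaussianLaw
  · have : arProcess a (fun i => U (ULift.up i)) l = fun w => w.1 l :=
      funext fun w => arPath_of_lt a w.1 _ l
    rw [this, integral_fun_fst (fun x : Fin p → ℝ => x l), h1, smul_zero]
  · have hZm : Measurable fun ω (i : ℕ) => U (ULift.up i) ω := measurable_pi_lambda _ fun i => hUm _
    rw [iIndepFun_iff_map_fun_eq_infinitePi_map (fun i => hAR.measurable_noise i)]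
    have h3 := hZi.map_fun_eq_infinitePi_map fun i => hUm _
    have h4 : ∀ {E : Type} [MeasurableSpace E] (f : Ω → E), Measurable f →
        (μ.prod P).map (fun w => f w.2) = P.map f := by
      intro E _ f hf
      have := Measure.map_map (μ := μ.prod P) hf measurable_snd
      rw [measurePreserving_snd.map_eq] at this
      exact this.symm
    rw [h4 _ hZm, h3]
    congr 1
    ext1 i
    exact (h4 _ (hUm _)).symm
  · rw [initialBlock_arProcess]
    exact indepFun_prod (X := id) (Y := fun ω (i : ℕ) => U (ULift.up i) ω) measurable_id
      (measurable_pi_lambda _ fun i => hUm _)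

end GaussMarkovExistence

/-! ### Noise made of independent blocks -/

section BlockNoise

variable {m : ℕ}

/-- The sequence obtained by concatenating the blocks `u 0, u 1, …` of length `m`. -/
def blockPath (hm : 0 < m) (u : ℕ → Fin m → ℝ) (i : ℕ) : ℝ := u (i / m) ⟨i % m, Nat.mod_lt i hm⟩

lemma measurable_blockPath (hm : 0 < m) (i : ℕ) :
    Measurable fun u : ℕ → Fin m → ℝ => blockPath hm u i :=
  (measurable_pi_apply _).comp (measurable_pi_apply _)

/-- The law of the first `n` members of the concatenation of independent blocks of law `μ`. -/
noncomputable def blockLaw (hm : 0 < m) (μ : Measure (Fin m → ℝ)) (n : ℕ) : Measure (Fin n → ℝ) :=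
  (Measure.infinitePi fun _ : ℕ => μ).map fun u i => blockPath hm u i

variable (hm : 0 < m) (μ : Measure (Fin m → ℝ)) [IsProbabilityMeasure μ]

lemma measurable_blockPath_pi (n : ℕ) :
    Measurable fun (u : ℕ → Fin m → ℝ) (i : Fin n) => blockPath hm u i :=
  measurable_pi_lambda _ fun i => measurable_blockPath hm i

instance (n : ℕ) : IsProbabilityMeasure (blockLaw hm μ n) :=
  Measure.isProbabilityMeasure_map (measurable_blockPath_pi hm n).aemeasurable

lemma blockPath_add (u : ℕ → Fin m → ℝ) (n : ℕ) :
    (fun i : Fin (m + n) => blockPath hm u i) =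
      Fin.append (u 0) fun i : Fin n => blockPath hm (fun j => u (j + 1)) i := by
  ext i
  induction i using Fin.addCases with
  | left i =>
    simp [blockPath, Nat.div_eq_of_lt i.2, Nat.mod_eq_of_lt i.2]
  | right i =>
    simp [blockPath, Nat.add_div_left _ hm]

lemma blockLaw_add (n : ℕ) :
    blockLaw hm μ (m + n) = (μ.prod (blockLaw hm μ n)).map (finAppend m n) := by
  set Q := Measure.infinitePi fun _ : ℕ => μ with hQ
  have hshift : Q.map (fun u j => u (j + 1)) = Q :=
    Measure.map_infinitePi_infinitePi_of_inj (P := fun _ : ℕ => μ) (add_left_injective 1)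
  have hind : iIndepFun (fun (i : ℕ) (u : ℕ → Fin m → ℝ) => u i) Q :=
    iIndepFun_infinitePi (P := fun _ : ℕ => μ) (X := fun _ x => x) fun _ => measurable_id
  have h1 : IndepFun (fun u : ℕ → Fin m → ℝ => u 0)
      (fun u (i : Fin n) => blockPath hm (fun j => u (j + 1)) i) Q := by
    -- Finitely many blocks suffice: entry `i < n` of the shifted path lies in block `i / m + 1 ≤
    -- n`.
    have h2 := hind.indepFun_finset {0} (Finset.Icc 1 n) (by simp) fun i => measurable_pi_apply i
    have hmem : ∀ i : Fin n, (i : ℕ) / m + 1 ∈ Finset.Icc 1 n := fun i => by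
      exact Finset.mem_Icc.2 ⟨Nat.le_add_left _ _, (Nat.div_le_self (i : ℕ) m).trans_lt i.2⟩
    exact h2.comp (φ := fun w : ({0} : Finset ℕ) → Fin m → ℝ => w ⟨0, Finset.mem_singleton_self 0⟩)
      (ψ := fun (w : Finset.Icc 1 n → Fin m → ℝ) (i : Fin n) =>
        w ⟨(i : ℕ) / m + 1, hmem i⟩ ⟨(i : ℕ) % m, Nat.mod_lt _ hm⟩)
      (measurable_pi_apply _)
      (measurable_pi_lambda _ fun i => (measurable_pi_apply _).comp (measurable_pi_apply _))
  have hsm : Measurable fun (u : ℕ → Fin m → ℝ) (j : ℕ) => u (j + 1) :=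
    measurable_pi_lambda _ fun j => measurable_pi_apply _
  have h3 : Q.map (fun u (i : Fin n) => blockPath hm (fun j => u (j + 1)) i) = blockLaw hm μ n := by
    rw [blockLaw, ← hQ, ← hshift, Measure.map_map (measurable_blockPath_pi hm n) hsm, hshift]
    rfl
  have h4 : Q.map (fun u : ℕ → Fin m → ℝ => u 0) = μ :=
    (measurePreserving_eval_infinitePi (fun _ : ℕ => μ) 0).map_eq
  have hm0 : Measurable fun u : ℕ → Fin m → ℝ => u 0 := measurable_pi_apply 0
  have hm1 : Measurable fun (u : ℕ → Fin m → ℝ) (i : Fin n) =>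
      blockPath hm (fun j => u (j + 1)) i := (measurable_blockPath_pi hm n).comp hsm
  have h5 := (indepFun_iff_map_prod_eq_prod_map_map hm0.aemeasurable hm1.aemeasurable).1 h1
  rw [h3, h4] at h5
  rw [← h5, Measure.map_map (MeasurableEquiv.measurable _) (hm0.prodMk hm1), blockLaw]
  congr 1
  ext1 u
  exact blockPath_add hm u n

lemma blockLaw_of_le {r : ℕ} (hr : r ≤ m) :
    blockLaw hm μ r = μ.map fun x i => x (Fin.castLE hr i) := by
  have h4 : (Measure.infinitePi fun _ : ℕ => μ).map (fun u : ℕ → Fin m → ℝ => u 0) = μ :=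
    (measurePreserving_eval_infinitePi (fun _ : ℕ => μ) 0).map_eq
  conv_rhs => rw [← h4]
  rw [blockLaw, Measure.map_map (measurable_pi_lambda _ fun i => measurable_pi_apply _)
    (measurable_pi_apply 0)]
  congr 1
  ext u i
  have : (i : ℕ) < m := i.2.trans_le hr
  simp [blockPath, Nat.div_eq_of_lt this, Nat.mod_eq_of_lt this]
  rfl

variable {μ}

lemma blockLaw_absolutelyContinuous (hμ : μ ≪ volume) (n : ℕ) : blockLaw hm μ n ≪ volume := by
  induction n using Nat.strong_induction_on with
  | _ n ih =>
    rcases lt_or_ge n m with h | h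
    · rw [blockLaw_of_le hm μ h.le]
      obtain ⟨k, rfl⟩ := Nat.exists_eq_add_of_le h.le
      exact absolutelyContinuous_map_castAdd hμ
    · obtain ⟨k, rfl⟩ := Nat.exists_eq_add_of_le h
      rw [blockLaw_add]
      exact absolutelyContinuous_map_finAppend hμ (ih k (by omega))

lemma renyiInt_blockLaw_add (hμ : μ ≪ volume) {α : ℝ} (hα : 0 ≤ α) (n : ℕ) :
    renyiInt α (blockLaw hm μ (m + n)) = renyiInt α μ * renyiInt α (blockLaw hm μ n) := by
  rw [blockLaw_add, renyiInt_finAppend _ _ hα hμ (blockLaw_absolutelyContinuous hm hμ n)]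

/-- The law `μ` is centered with second-moment matrix `v • 1`. -/
structure IsIsotropic {m : ℕ} (v : ℝ) (μ : Measure (Fin m → ℝ)) : Prop where
  memLp : ∀ i, MemLp (fun x : Fin m → ℝ => x i) 2 μ
  integral_eq_zero : ∀ i, ∫ x, x i ∂μ = 0
  integral_mul : ∀ i j, i ≠ j → ∫ x, x i * x j ∂μ = 0
  integral_sq : ∀ i, ∫ x, x i * x i ∂μ = v

/-- Correlations vanish inside a block by isotropy and across blocks by independence; the
coordinates of one block may depend on each other. -/
lemma isWhiteNoise_blockPath {Ω : Type*} [MeasurableSpace Ω] {P : Measure Ω}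
    {μ : Measure (Fin m → ℝ)} {U : ℕ → Ω → Fin m → ℝ} (hU : ∀ i, Measurable (U i)) (hUl : ∀ i, HasLaw (U i) μ P)
    (hUi : iIndepFun U P) {v : ℝ} (hv : IsIsotropic v μ) :
    IsWhiteNoise v P fun i ω => blockPath hm (fun j => U j ω) i := by
  have hmeas : ∀ i, Measurable fun ω => blockPath hm (fun j => U j ω) i := fun i =>
    (measurable_pi_apply _).comp (hU _)
  have h0 : ∀ i, ∫ ω, blockPath hm (fun j => U j ω) i ∂P = 0 := fun i =>
    ((hUl (i / m)).integral_comp (measurable_pi_apply (X := fun _ : Fin m => ℝ)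
      _).aestronglyMeasurable).trans (hv.integral_eq_zero ⟨i % m, Nat.mod_lt i hm⟩)
  have h2 : ∀ q k l, ∫ ω, U q ω k * U q ω l ∂P = ∫ x, x k * x l ∂μ := fun q k l => by
    have h3 : Measurable fun x : Fin m → ℝ => x k * x l :=
      (measurable_pi_apply k).mul (measurable_pi_apply l)
    exact (hUl q).integral_comp h3.aestronglyMeasurable
  exact {
    measurable := hmeas
    memLp := fun i => (hv.memLp _).comp_measurePreserving ((hUl _).measurePreserving (hU _))
    integral_eq_zero := h0
    integral_mul := fun i j hij => by
      rcases eq_or_ne (i / m) (j / m) with h | h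
      · simp only [blockPath, h]
        rw [h2]
        refine hv.integral_mul _ _ fun h3 => ?_
        have h4 : i % m = j % m := congrArg Fin.val h3
        have h5 := Nat.div_add_mod i m
        have h6 := Nat.div_add_mod j m
        rw [h, h4] at h5
        omega
      · have h1 := (hUi.indepFun h).comp
          (measurable_pi_apply (X := fun _ : Fin m => ℝ) ⟨i % m, Nat.mod_lt i hm⟩)
          (measurable_pi_apply (X := fun _ : Fin m => ℝ) ⟨j % m, Nat.mod_lt j hm⟩)
        have := h1.integral_fun_mul_eq_mul_integral (hmeas i).aestronglyMeasurable
          (hmeas j).aestronglyMeasurable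
        refine this.trans ?_
        exact mul_eq_zero_of_left (h0 i) _
    integral_sq := fun i => (h2 _ _ _).trans (hv.integral_sq _) }

/-- Here `I α` is the Rényi integral of the Gaussian initial vector. -/
lemma exists_block_process {p : ℕ} {γ : ℕ → ℝ} (hγ : (toeplitz γ (p + 1)).PosDef) {a : Fin p → ℝ}
    {v : ℝ} (hyw : YuleWalker γ p a v) (hv : IsIsotropic v μ) (hμ : μ ≪ volume) :
    ∃ (Ω : Type u) (_ : MeasurableSpace Ω) (P : Measure Ω) (X : ℕ → Ω → ℝ) (I : ℝ → ℝ≥0∞),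
      IsProbabilityMeasure P ∧ SatisfiesBurg γ p P X ∧
      (∀ n, HasPDF (initialBlock X n) P volume) ∧ (∀ α, 0 < α → I α ≠ 0) ∧
      (∀ α, 1 < α → I α ≠ ⊤) ∧ ∀ α, 0 ≤ α → ∀ n,
        renyiInt α (P.map (initialBlock X (p + n))) = I α * renyiInt α (blockLaw hm μ n) := by
  obtain ⟨μ₀, hμg, hμ0, hI, h1, h2⟩ :=
    exists_gaussian_init (toeplitz_castLE_posDef hγ (Nat.le_succ p))
  obtain ⟨Ω, _, P, U, hUm, hUl, hUi, hP⟩ := exists_iid (ULift.{u} ℕ) μ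
  have hZi : iIndepFun (fun i => U (ULift.up i)) P := hUi.precomp ULift.up_injective
  set Z : ℕ → Ω → ℝ := fun i ω => blockPath hm (fun j => U (ULift.up j) ω) i with hZdef
  have hZ : IsWhiteNoise v P Z :=
    isWhiteNoise_blockPath hm (fun i => hUm _) (fun i => hUl _) hZi hv
  have hlaw : ∀ n, P.map (initialBlock Z n) = blockLaw hm μ n := by
    intro n
    have h3 := hZi.map_fun_eq_infinitePi_map fun i => hUm _
    have h4 : ∀ i, P.map (U i) = μ := fun i => (hUl i).map_eq
    simp only [h4] at h3
    rw [blockLaw, ← h3, Measure.map_map (measurable_blockPath_pi hm n)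
      (measurable_pi_lambda _ fun i => hUm _)]
    rfl
  have hac : ∀ n, P.map (initialBlock Z n) ≪ volume := fun n => by
    rw [hlaw]
    exact blockLaw_absolutelyContinuous hm hμ n
  have hAR := isAutoregression_arProcess a hZ h1 h2
  have hX := hAR.satisfiesBurg hyw
  refine ⟨(Fin p → ℝ) × Ω, inferInstance, μ₀.prod P, arProcess a Z, fun α => renyiInt α μ₀,
    inferInstance, hX, fun n => ⟨(hX.measurable_initialBlock n).aemeasurable, inferInstance, ?_⟩,
    fun α hα => renyiInt_ne_zero μ₀ hμ0 hα, hI, fun α hα n => ?_⟩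
  · exact absolutelyContinuous_map_initialBlock hX.measurable (Nat.le_add_left n p)
      (renyiInt_arProcess a hZ.measurable hμ0 (hac n)).1
  · rw [(renyiInt_arProcess a hZ.measurable hμ0 (hac n)).2 α hα, hlaw]

/-- Once one full block fits, one factor of the Rényi integral is infinite and the others are
nonzero, so the entropy is `⊤` for all `N ≥ p + m`. -/
lemma top_mem_burgRenyiRates (hm : 0 < m) {p : ℕ} {γ : ℕ → ℝ} (hγ : (toeplitz γ (p + 1)).PosDef)
    {a : Fin p → ℝ} {v : ℝ} (hyw : YuleWalker γ p a v) (hv : IsIsotropic v μ) (hμ : μ ≪ volume)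
    {α : ℝ} (hα0 : 0 < α) (hα1 : α < 1) (hI : renyiInt α μ = ⊤) :
    (⊤ : EReal) ∈ burgRenyiRates.{u} γ p α := by
  obtain ⟨Ω, _, P, X, I, hP, hX, hpdf, hI0, -, hIn⟩ := exists_block_process.{u} hm hγ hyw hv hμ
  refine ⟨Ω, _, P, X, hP, hX, hpdf, tendsto_const_nhds.congr' ?_⟩
  filter_upwards [eventually_ge_atTop (p + m)] with N hN
  obtain ⟨n, rfl⟩ := Nat.exists_eq_add_of_le hN
  have h1 : renyiInt α (P.map (initialBlock X (p + m + n))) = ⊤ := by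
    rw [add_assoc, hIn α hα0.le, renyiInt_blockLaw_add hm hμ hα0.le, hI,
      ENNReal.top_mul (renyiInt_ne_zero _ (blockLaw_absolutelyContinuous hm hμ n) hα0),
      ENNReal.mul_top (hI0 α hα0)]
  have h2 : renyiEntropy α (pdf (initialBlock X (p + m + n)) P volume) = ⊤ := by
    change (((1 - α)⁻¹ : ℝ) : EReal) * ENNReal.log (renyiInt α _) = ⊤
    rw [h1, ENNReal.log_top, EReal.coe_mul_top_of_pos (inv_pos.2 (by linarith))]
  rw [h2, EReal.coe_mul_top_of_pos]
  have : 0 < p + m + n := by omega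
  positivity

lemma mem_burgRenyiRates {p : ℕ} {γ : ℕ → ℝ} (hγ : (toeplitz γ (p + 1)).PosDef)
    {a : Fin p → ℝ} {v : ℝ} (hyw : YuleWalker γ p a v) (hv : IsIsotropic v μ) (hμ : μ ≪ volume)
    {α : ℝ} (hα : 1 < α) (hI : renyiInt α μ ≠ ⊤)
    (hr : ∀ r < m, renyiInt α (blockLaw hm μ r) ≠ ⊤) :
    (((1 - α)⁻¹ * Real.log (renyiInt α μ).toReal / m : ℝ) : EReal) ∈
      burgRenyiRates.{u} γ p α := by
  have hα0 : 0 < α := by linarith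
  obtain ⟨Ω, _, P, X, I, hP, hX, hpdf, hI0, hItop, hIn⟩ :=
    exists_block_process.{u} hm hγ hyw hv hμ
  set J : ℕ → ℝ≥0∞ := fun n => renyiInt α (blockLaw hm μ n) with hJ
  have hJ0 : ∀ n, J n ≠ 0 := fun n =>
    renyiInt_ne_zero _ (blockLaw_absolutelyContinuous hm hμ n) hα0
  have hμ0 : renyiInt α μ ≠ 0 := renyiInt_ne_zero μ hμ hα0
  have hJadd : ∀ n, J (m + n) = renyiInt α μ * J n := renyiInt_blockLaw_add hm hμ hα0.le
  have hJtop : ∀ n, J n ≠ ⊤ := by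
    intro n
    induction n using Nat.strong_induction_on with
    | _ n ih =>
      rcases lt_or_ge n m with h | h
      · exact hr n h
      · obtain ⟨k, rfl⟩ := Nat.exists_eq_add_of_le h
        rw [hJadd]
        exact ENNReal.mul_ne_top hI (ih k (by omega))
  set A := Real.log (renyiInt α μ).toReal with hA
  -- Each further block adds exactly `A` to `log J`, so the deviation `b` from linear growth is
  -- `m`-periodic, hence bounded; `hr` makes it meaningful on incomplete blocks.
  set b : ℕ → ℝ := fun n => Real.log (J n).toReal - A / m * n with hb
  have hm' : (m : ℝ) ≠ 0 := by positivity
  have hbper : ∀ n, b (m + n) = b n := by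
    intro n
    simp only [hb, hJadd, ENNReal.toReal_mul]
    rw [Real.log_mul (ENNReal.toReal_pos hμ0 hI).ne' (ENNReal.toReal_pos (hJ0 n) (hJtop n)).ne',
      ← hA]
    push_cast
    field_simp
    ring
  obtain ⟨D, hD⟩ : ∃ D, ∀ n, |b n| ≤ D := by
    refine ⟨∑ r ∈ Finset.range m, |b r|, fun n => ?_⟩
    induction n using Nat.strong_induction_on with
    | _ n ih =>
      rcases lt_or_ge n m with h | h
      · exact Finset.single_le_sum (f := fun r => |b r|) (fun _ _ => abs_nonneg _)
          (Finset.mem_range.2 h)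
      · obtain ⟨k, rfl⟩ := Nat.exists_eq_add_of_le h
        rw [hbper]
        exact ih k (by omega)
  refine ⟨Ω, _, P, X, hP, hX, hpdf, ?_⟩
  refine tendsto_inv_mul_linear (D := |(1 - α)⁻¹| * (|Real.log (I α).toReal - A / m * p| + D))
    (b := fun N => (1 - α)⁻¹ * (Real.log (I α).toReal - A / m * p + b (N - p))) ?_ fun N => ?_
  · filter_upwards [eventually_ge_atTop p] with N hN
    obtain ⟨n, rfl⟩ := Nat.exists_eq_add_of_le hN
    change (((1 - α)⁻¹ : ℝ) : EReal) * ENNReal.log (renyiInt α _) = _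
    have hI1 := hI0 α hα0
    have hI2 := hItop α hα
    rw [hIn α hα0.le n, ENNReal.log_pos_real (mul_ne_zero hI1 (hJ0 n))
      (ENNReal.mul_ne_top hI2 (hJtop n)), ← EReal.coe_mul, ENNReal.toReal_mul,
      Real.log_mul (ENNReal.toReal_pos hI1 hI2).ne' (ENNReal.toReal_pos (hJ0 n) (hJtop n)).ne']
    congr 1
    simp only [hb, add_tsub_cancel_left]
    push_cast
    field_simp
    ring
  · rw [abs_mul]
    refine mul_le_mul_of_nonneg_left ((abs_add_le _ _).trans ?_) (abs_nonneg _)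
    gcongr
    exact hD _

end BlockNoise

/-! ### Isotropy from symmetry, and rescaling -/

section IsotropicLaws

variable {m : ℕ}

lemma MeasurePreserving.withDensity_of_comp_eq {E : Type*} [MeasurableSpace E] {μ : Measure E}
    {g : E → E} (hg : MeasurePreserving g μ μ) {f : E → ℝ≥0∞} (hf : Measurable f)
    (hfg : ∀ x, f (g x) = f x) : MeasurePreserving g (μ.withDensity f) (μ.withDensity f) := by
  refine ⟨hg.measurable, ?_⟩
  ext s hs
  rw [Measure.map_apply hg.measurable hs, withDensity_apply _ (hg.measurable hs),
    withDensity_apply _ hs, ← hg.setLIntegral_comp_preimage hs hf]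
  simp only [hfg]

/-- The map which changes the sign of the `i`-th coordinate. -/
def flipSign (i : Fin m) (x : Fin m → ℝ) : Fin m → ℝ := fun j => if j = i then -x j else x j

lemma measurePreserving_flipSign (i : Fin m) :
    MeasurePreserving (flipSign i) (volume : Measure (Fin m → ℝ)) volume := by
  refine volume_preserving_pi (f := fun j (t : ℝ) => if j = i then -t else t) fun j => ?_
  split_ifs
  · exact Measure.measurePreserving_neg volume
  · exact MeasurePreserving.id volume

lemma measurePreserving_comp_perm (σ : Equiv.Perm (Fin m)) :
    MeasurePreserving (fun x : Fin m → ℝ => x ∘ σ) volume volume :=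
  (volume_measurePreserving_piCongrLeft (fun _ : Fin m => ℝ) σ).symm

lemma volume_eval_eq_zero (i : Fin m) : volume {x : Fin m → ℝ | x i = 0} = 0 := by
  exact Measure.pi_hyperplane (fun _ : Fin m => (volume : Measure ℝ)) i 0

/-- Sign flips annihilate means and mixed moments, permutations equalize the variances, and `c > 0`
because a hyperplane is a null set. -/
lemma exists_isIsotropic {f : (Fin m → ℝ) → ℝ≥0∞} (hm : 0 < m) (hf : Measurable f)
    (hprob : IsProbabilityMeasure (volume.withDensity f))
    (hL : ∀ i, MemLp (fun x : Fin m → ℝ => x i) 2 (volume.withDensity f))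
    (hflip : ∀ i x, f (flipSign i x) = f x)
    (hperm : ∀ (σ : Equiv.Perm (Fin m)) x, f (x ∘ σ) = f x) :
    ∃ c > 0, IsIsotropic c (volume.withDensity f) := by
  set μ := (volume : Measure (Fin m → ℝ)).withDensity f with hμ
  have h1 : ∀ i, MeasurePreserving (flipSign i) μ μ := fun i =>
    MeasurePreserving.withDensity_of_comp_eq (measurePreserving_flipSign i) hf (hflip i)
  have h2 : ∀ σ : Equiv.Perm (Fin m), MeasurePreserving (fun x => x ∘ σ) μ μ := fun σ =>
    MeasurePreserving.withDensity_of_comp_eq (measurePreserving_comp_perm σ) hf (hperm σ)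
  have hint : ∀ {g : (Fin m → ℝ) → (Fin m → ℝ)} (_ : MeasurePreserving g μ μ)
      {F : (Fin m → ℝ) → ℝ} (_ : Measurable F), ∫ x, F (g x) ∂μ = ∫ x, F x ∂μ := by
    intro g hg F hF
    conv_rhs => rw [← hg.map_eq]
    rw [integral_map hg.measurable.aemeasurable hF.aestronglyMeasurable]
  have hmul : ∀ i j, Measurable fun x : Fin m → ℝ => x i * x j := fun i j =>
    (measurable_pi_apply i).mul (measurable_pi_apply j)
  refine ⟨∫ x, x ⟨0, hm⟩ * x ⟨0, hm⟩ ∂μ, ?_, hL, fun i => ?_, fun i j hij => ?_, fun i => ?_⟩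
  · have hnn : 0 ≤ ∫ x, x ⟨0, hm⟩ * x ⟨0, hm⟩ ∂μ := integral_nonneg fun x => mul_self_nonneg _
    refine lt_of_le_of_ne hnn fun h => ?_
    have hi : Integrable (fun x : Fin m → ℝ => x ⟨0, hm⟩ * x ⟨0, hm⟩) μ :=
      (hL _).integrable_mul (hL _)
    have h0 := (integral_eq_zero_iff_of_nonneg (fun x => mul_self_nonneg _) hi).1 h.symm
    have h3 : ∀ᵐ x ∂μ, x ⟨0, hm⟩ ≠ 0 := by
      refine (withDensity_absolutelyContinuous volume f).ae_le (ae_iff.2 ?_)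
      simpa using volume_eval_eq_zero (⟨0, hm⟩ : Fin m)
    obtain ⟨x, hx, hx'⟩ := (h0.and h3).exists
    exact hx' (mul_self_eq_zero.1 hx)
  · have := hint (h1 i) (measurable_pi_apply i)
    simp only [flipSign, if_true, integral_neg] at this
    linarith
  · have := hint (h1 i) (hmul i j)
    simp only [flipSign, if_true, if_neg hij.symm, neg_mul, integral_neg] at this
    linarith
  · exact hint (h2 (Equiv.swap ⟨0, hm⟩ i)) (hmul ⟨0, hm⟩ ⟨0, hm⟩) |>.symm.trans (by simp) |>.symm

lemma IsIsotropic.map_smul {c : ℝ} {μ : Measure (Fin m → ℝ)} (h : IsIsotropic c μ) {s : ℝ}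
    (hs : s ≠ 0) :
    IsIsotropic (s ^ 2 * c) (μ.map (linEquiv (LinearEquiv.smulOfNeZero ℝ (Fin m → ℝ) s hs))) := by
  refine ⟨fun i => ?_, fun i => ?_, fun i j hij => ?_, fun i => ?_⟩
  · rw [MeasurableEmbedding.memLp_map_measure_iff (MeasurableEquiv.measurableEmbedding _)]
    exact (h.memLp i).const_mul s
  · rw [MeasureTheory.integral_map_equiv]
    simp [integral_const_mul, h.integral_eq_zero]
  · rw [MeasureTheory.integral_map_equiv]
    simp [mul_mul_mul_comm, integral_const_mul, h.integral_mul i j hij]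
  · rw [MeasureTheory.integral_map_equiv]
    simp [mul_mul_mul_comm, integral_const_mul, h.integral_sq i, sq]

lemma renyiInt_map_smul {μ : Measure (Fin m → ℝ)} [IsFiniteMeasure μ] (hμ : μ ≪ volume) {s α : ℝ}
    (hs : 0 < s) (hα : 0 ≤ α) :
    renyiInt α (μ.map (linEquiv (LinearEquiv.smulOfNeZero ℝ (Fin m → ℝ) s hs.ne'))) =
      ENNReal.ofReal ((s ^ m) ^ (1 - α)) * renyiInt α μ := by
  have : ((LinearEquiv.smulOfNeZero ℝ (Fin m → ℝ) s hs.ne' : (Fin m → ℝ) ≃ₗ[ℝ] (Fin m → ℝ)) :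
      (Fin m → ℝ) →ₗ[ℝ] (Fin m → ℝ)) = s • LinearMap.id := by
    ext; simp
  rw [renyiInt_map_linEquiv _ _ hμ hα, this, LinearMap.det_smul]
  simp [abs_of_pos hs]

end IsotropicLaws

/-! ### Infinite rates below order one -/

section HeavyTails

variable {m : ℕ}

/-- On the sup-norm ball of radius `t ≥ 1`, of volume `(2t)^m ≥ (1 + t)^m`, the integrand is at
least `(1 + t)^(-q)`; the resulting bound `(1 + t)^(m - q)` is unbounded. -/
lemma lintegral_one_add_norm_eq_top {q : ℝ} (hq0 : 0 ≤ q) (hq : q < m) :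
    ∫⁻ x : Fin m → ℝ, ENNReal.ofReal ((1 + ‖x‖) ^ (-q)) = ⊤ := by
  have h1 : Tendsto (fun t : ℝ => ENNReal.ofReal ((1 + t) ^ (m - q))) atTop (𝓝 ⊤) :=
    ENNReal.tendsto_ofReal_atTop.comp
      ((tendsto_rpow_atTop (sub_pos.2 hq)).comp (tendsto_atTop_add_const_left _ _ tendsto_id))
  refine top_le_iff.1 (le_of_tendsto h1 ?_)
  filter_upwards [eventually_ge_atTop 1] with t ht
  have ht0 : 0 ≤ t := by linarith
  calc ENNReal.ofReal ((1 + t) ^ (m - q))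
      ≤ ENNReal.ofReal ((1 + t) ^ (-q)) * ENNReal.ofReal ((2 * t) ^ m) := by
        rw [← ENNReal.ofReal_mul (by positivity), sub_eq_neg_add, Real.rpow_add (by positivity),
          Real.rpow_natCast]
        gcongr
        linarith
    _ = ∫⁻ x in Metric.closedBall (0 : Fin m → ℝ) t, ENNReal.ofReal ((1 + t) ^ (-q)) := by
        rw [setLIntegral_const, Real.volume_pi_closedBall _ ht0, Fintype.card_fin]
    _ ≤ ∫⁻ x in Metric.closedBall (0 : Fin m → ℝ) t, ENNReal.ofReal ((1 + ‖x‖) ^ (-q)) := by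
        refine setLIntegral_mono' Metric.isClosed_closedBall.measurableSet fun x hx => ?_
        refine ENNReal.ofReal_le_ofReal (Real.rpow_le_rpow_of_nonpos (by positivity) ?_ (by linarith))
        linarith [mem_closedBall_zero_iff.1 hx]
    _ ≤ _ := setLIntegral_le_lintegral _ _

lemma norm_flipSign (i : Fin m) (x : Fin m → ℝ) : ‖flipSign i x‖ = ‖x‖ := by
  simp only [Pi.norm_def, flipSign]
  congr 2
  ext j
  split_ifs <;> simp

lemma norm_comp_perm (σ : Equiv.Perm (Fin m)) (x : Fin m → ℝ) : ‖x ∘ σ‖ = ‖x‖ := by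
  refine le_antisymm ((pi_norm_le_iff_of_nonneg (norm_nonneg _)).2 fun i => norm_le_pi_norm x _)
    ((pi_norm_le_iff_of_nonneg (norm_nonneg _)).2 fun i => ?_)
  simpa using norm_le_pi_norm (x ∘ σ) (σ.symm i)

lemma exists_isIsotropic_renyiInt_eq_top {α : ℝ} (hα0 : 0 < α) (hα1 : α < 1) :
    ∃ (m : ℕ) (_ : 0 < m) (μ : Measure (Fin m → ℝ)) (_ : IsProbabilityMeasure μ) (c : ℝ),
      0 < c ∧ IsIsotropic c μ ∧ μ ≪ volume ∧ renyiInt α μ = ⊤ := by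
  -- This bound on `m` is equivalent to `(m + 3) * α < m`, the divergence condition for the `α`-th
  -- power.
  obtain ⟨m, hm⟩ := exists_nat_gt (3 * α / (1 - α))
  have hm0 : 0 < m := by
    have : 0 ≤ 3 * α / (1 - α) := div_nonneg (by linarith) (by linarith)
    exact_mod_cast this.trans_lt hm
  have hq : ((m : ℝ) + 3) * α < m := by
    rw [div_lt_iff₀ (by linarith)] at hm
    linarith
  -- Of the exponent `m + 3`, two powers are spent on `x i ^ 2`; the remaining `m + 1` is still
  -- integrable.
  set g : (Fin m → ℝ) → ℝ≥0∞ := fun x => ENNReal.ofReal ((1 + ‖x‖) ^ (-((m : ℝ) + 3))) with hg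
  have hgm : Measurable g := by fun_prop
  have hgpos : ∀ x : Fin m → ℝ, 0 < (1 + ‖x‖) ^ (-((m : ℝ) + 3)) := fun x => by positivity
  have hfin : ∀ r : ℝ, 0 < r →
      ∫⁻ x : Fin m → ℝ, ENNReal.ofReal ((1 + ‖x‖) ^ (-((m : ℝ) + r))) < ⊤ := fun r hr =>
    finite_integral_one_add_norm (by simpa using hr)
  set Z := ∫⁻ x, g x with hZ
  have hZtop : Z ≠ ⊤ := (hfin 3 (by norm_num)).ne
  have hZ0 : Z ≠ 0 := by
    intro h
    rw [hZ, lintegral_eq_zero_iff hgm] at h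
    obtain ⟨x, hx⟩ := h.exists
    exact (ENNReal.ofReal_pos.2 (hgpos x)).ne' hx
  have hZi : Z⁻¹ ≠ ⊤ := ENNReal.inv_ne_top.2 hZ0
  have hfm : Measurable fun x => Z⁻¹ * g x := hgm.const_mul _
  have hprob : IsProbabilityMeasure (volume.withDensity fun x => Z⁻¹ * g x) := by
    refine ⟨?_⟩
    rw [withDensity_apply _ MeasurableSet.univ, Measure.restrict_univ, lintegral_const_mul _ hgm,
      ENNReal.inv_mul_cancel hZ0 hZtop]
  have hL : ∀ i, MemLp (fun x : Fin m → ℝ => x i) 2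
      (volume.withDensity fun x => Z⁻¹ * g x) := fun i => by
    have hi : Measurable fun x : Fin m → ℝ => x i := measurable_pi_apply i
    rw [memLp_two_iff_integrable_sq hi.aestronglyMeasurable]
    refine ⟨(hi.pow_const 2).aestronglyMeasurable, ?_⟩
    rw [hasFiniteIntegral_iff_ofReal (ae_of_all _ fun x => sq_nonneg _),
      lintegral_withDensity_eq_lintegral_mul _ hfm (hi.pow_const 2).ennreal_ofReal]
    simp only [Pi.mul_apply, mul_assoc]
    rw [lintegral_const_mul' _ _ hZi]
    refine ENNReal.mul_lt_top hZi.lt_top (lt_of_le_of_lt (lintegral_mono fun x => ?_)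
      (hfin 1 one_pos))
    rw [hg, ← ENNReal.ofReal_mul (hgpos x).le]
    refine ENNReal.ofReal_le_ofReal ?_
    have h2 : x i ^ 2 ≤ (1 + ‖x‖) ^ (2 : ℝ) := by
      rw [Real.rpow_two, ← sq_abs (x i)]
      have := norm_le_pi_norm x i
      rw [Real.norm_eq_abs] at this
      gcongr
      linarith
    calc _ ≤ (1 + ‖x‖) ^ (-((m : ℝ) + 3)) * (1 + ‖x‖) ^ (2 : ℝ) := by gcongr
      _ = _ := by
        rw [← Real.rpow_add (by positivity)]
        congr 1
        ring
  obtain ⟨c, hc, h⟩ := exists_isIsotropic hm0 hfm hprob hL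
    (fun i x => by simp only [hg, norm_flipSign]) (fun σ x => by simp only [hg, norm_comp_perm])
  refine ⟨m, hm0, _, hprob, c, hc, h, withDensity_absolutelyContinuous _ _, ?_⟩
  rw [renyiInt_withDensity hfm]
  simp only [ENNReal.mul_rpow_of_nonneg _ _ hα0.le]
  rw [lintegral_const_mul _ (hgm.pow_const α)]
  have h1 : ∀ x, g x ^ α = ENNReal.ofReal ((1 + ‖x‖) ^ (-((m + 3) * α))) := fun x => by
    rw [hg, ENNReal.ofReal_rpow_of_pos (hgpos x), ← Real.rpow_mul (by positivity), neg_mul]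
  simp only [h1]
  rw [lintegral_one_add_norm_eq_top (by positivity) hq, ENNReal.mul_top]
  exact (ENNReal.rpow_pos (ENNReal.inv_pos.2 hZtop) hZi).ne'

lemma sSup_burgRenyiRates_eq_top {p : ℕ} {γ : ℕ → ℝ} (hγ : (toeplitz γ (p + 1)).PosDef) {α : ℝ}
    (hα0 : 0 < α) (hα1 : α < 1) : sSup (burgRenyiRates.{u} γ p α) = ⊤ := by
  obtain ⟨a, v, hyw⟩ := exists_yuleWalker hγ
  have hv := hyw.pos hγ
  obtain ⟨m, hm, μ, _, c, hc, hμi, hμ, hI⟩ := exists_isIsotropic_renyiInt_eq_top hα0 hα1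
  have hs : 0 < √(v / c) := by positivity
  have h1 := hμi.map_smul hs.ne'
  have h2 : IsProbabilityMeasure
      (μ.map (linEquiv (LinearEquiv.smulOfNeZero ℝ (Fin m → ℝ) _ hs.ne'))) :=
    Measure.isProbabilityMeasure_map (MeasurableEquiv.measurable _).aemeasurable
  rw [Real.sq_sqrt (by positivity), div_mul_cancel₀ _ hc.ne'] at h1
  refine top_le_iff.1 (le_sSup (top_mem_burgRenyiRates hm hγ hyw h1
    (absolutelyContinuous_map_linEquiv _ hμ) hα0 hα1 ?_))
  rw [renyiInt_map_smul hμ hs hα0.le, hI, ENNReal.mul_top]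
  exact (ENNReal.ofReal_pos.2 (by positivity)).ne'

end HeavyTails

/-! ### Uniform laws on balls -/

section UniformBall

variable {m : ℕ}

/-- Integrating out `t` coordinates confined to `[-R, R]` multiplies the density bound by the volume
of a cube. This controls an incomplete last block. -/
lemma renyiInt_map_castAdd_ne_top {r t : ℕ} {ν : Measure (Fin (r + t) → ℝ)}
    [IsProbabilityMeasure ν] {K : ℝ≥0∞} (hK : K ≠ ⊤) (hν : ν ≤ K • volume) {R : ℝ}
    (hR : ∀ᵐ x ∂ν, ∀ i, |x i| ≤ R) {α : ℝ} (hα : 1 < α) :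
    renyiInt α (ν.map fun x i => x (Fin.castAdd t i)) ≠ ⊤ := by
  have hmeas : Measurable fun (x : Fin (r + t) → ℝ) (i : Fin r) => x (Fin.castAdd t i) :=
    measurable_pi_lambda _ fun i => measurable_pi_apply _
  have hprob : IsProbabilityMeasure (ν.map fun x i => x (Fin.castAdd t i)) :=
    Measure.isProbabilityMeasure_map hmeas.aemeasurable
  set S : Set (Fin t → ℝ) := Set.univ.pi fun _ => Set.Icc (-R) R with hS
  have hSm : MeasurableSet S := MeasurableSet.univ_pi fun _ => measurableSet_Icc
  have hSv : volume S ≠ ⊤ := (isCompact_univ_pi fun _ => isCompact_Icc).measure_lt_top.ne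
  refine renyiInt_ne_top_of_le_smul (K := K * volume S) (ENNReal.mul_ne_top hK hSv) ?_ hα
  refine Measure.le_iff.2 fun A hA => ?_
  have hAS : volume (finAppend r t '' (A ×ˢ S)) = volume A * volume S := by
    rw [← volume_map_finAppend, MeasurableEquiv.map_apply,
      Set.preimage_image_eq _ (MeasurableEquiv.injective _), Measure.prod_prod]
  rw [Measure.map_apply hmeas hA]
  calc ν ((fun x i => x (Fin.castAdd t i)) ⁻¹' A) ≤ ν (finAppend r t '' (A ×ˢ S)) := by
        refine measure_mono_ae ?_
        filter_upwards [hR] with x hx hxA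
        refine ⟨(fun i => x (Fin.castAdd t i), fun i => x (Fin.natAdd r i)),
          ⟨hxA, fun i _ => abs_le.1 (hx _)⟩, ?_⟩
        rw [finAppend_apply]
        exact Fin.append_castAdd_natAdd
    _ ≤ K * volume (finAppend r t '' (A ×ˢ S)) := hν _
    _ = (K * volume S) * volume A := by rw [hAS]; ring

/-- In even dimension the Gamma factor is a factorial. -/
lemma volume_sum_sq_lt_one (k : ℕ) :
    volume {x : Fin (2 * k) → ℝ | ∑ i, x i ^ 2 < 1} =
      ENNReal.ofReal (Real.pi ^ k / k.factorial) := by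
  have h := volume_sum_rpow_lt_one (Fin (2 * k)) (p := 2) (by norm_num)
  simp only [Real.rpow_two, sq_abs, Fintype.card_fin] at h
  rw [h]
  have h2 : (2 * Real.Gamma (1 / 2 + 1)) ^ (2 * k) = Real.pi ^ k := by
    rw [Real.Gamma_add_one (by norm_num), Real.Gamma_one_half_eq, pow_mul]
    congr 1
    rw [← mul_assoc]
    norm_num
    exact Real.sq_sqrt Real.pi_pos.le
  rw [h2]
  push_cast
  rw [mul_div_cancel_left₀ _ (two_ne_zero' ℝ), Real.Gamma_nat_eq_factorial]

/-- `2k * c` is the mean of `∑ x_i²`, at most `1` on the ball. The density is the constant `1 / w`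
there, whence `w * w ^ (-α)` for the Rényi integral. -/
lemma exists_isIsotropic_ball {k : ℕ} (hk : 0 < k) :
    ∃ (μ : Measure (Fin (2 * k) → ℝ)) (_ : IsProbabilityMeasure μ) (c : ℝ) (K : ℝ≥0∞),
      0 < c ∧ (2 * k : ℕ) * c ≤ 1 ∧ IsIsotropic c μ ∧ K ≠ ⊤ ∧ μ ≤ K • volume ∧
      (∀ᵐ x ∂μ, ∀ i, |x i| ≤ 1) ∧ ∀ α : ℝ, 0 < α →
        renyiInt α μ = ENNReal.ofReal ((Real.pi ^ k / k.factorial) ^ (1 - α)) := by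
  set B : Set (Fin (2 * k) → ℝ) := {x | ∑ i, x i ^ 2 < 1} with hB
  have hBm : MeasurableSet B := measurableSet_lt (by fun_prop) measurable_const
  set w : ℝ := Real.pi ^ k / k.factorial with hw
  have hw0 : 0 < w := by positivity
  have hBv : volume B = ENNReal.ofReal w := volume_sum_sq_lt_one k
  have hV0 : ENNReal.ofReal w ≠ 0 := (ENNReal.ofReal_pos.2 hw0).ne'
  set K : ℝ≥0∞ := (ENNReal.ofReal w)⁻¹ with hKd
  have hK : K ≠ ⊤ := ENNReal.inv_ne_top.2 hV0
  have hfm : Measurable (B.indicator fun _ => K) := measurable_const.indicator hBm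
  set μ := (volume : Measure (Fin (2 * k) → ℝ)).withDensity (B.indicator fun _ => K) with hμ
  have hμr : μ = K • volume.restrict B := by
    rw [hμ, withDensity_indicator hBm, withDensity_const]
  have hprob : IsProbabilityMeasure μ := by
    refine ⟨?_⟩
    rw [hμr, Measure.smul_apply, Measure.restrict_apply_univ, hBv, smul_eq_mul,
      ENNReal.inv_mul_cancel hV0 ENNReal.ofReal_ne_top]
  have hmem : ∀ᵐ x ∂μ, x ∈ B := by
    rw [hμr]
    exact Measure.ae_smul_measure (ae_restrict_mem hBm) K
  have habs : ∀ᵐ x ∂μ, ∀ i, |x i| ≤ 1 := by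
    filter_upwards [hmem] with x hx i
    rw [← sq_le_one_iff_abs_le_one]
    exact (Finset.single_le_sum (f := fun i => x i ^ 2) (fun _ _ => sq_nonneg _)
      (Finset.mem_univ i)).trans hx.le
  have hL : ∀ i, MemLp (fun x : Fin (2 * k) → ℝ => x i) 2 μ := fun i =>
    MemLp.of_bound (measurable_pi_apply i).aestronglyMeasurable 1
      (habs.mono fun x hx => by simpa using hx i)
  have hflip : ∀ i x, flipSign i x ∈ B ↔ x ∈ B := fun i x => by
    have : ∀ j, flipSign i x j ^ 2 = x j ^ 2 := fun j => by
      simp only [flipSign]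
      split_ifs <;> simp
    simp only [hB, Set.mem_ofPred_eq, this]
  have hperm : ∀ (σ : Equiv.Perm (Fin (2 * k))) x, x ∘ σ ∈ B ↔ x ∈ B := fun σ x => by
    simp only [hB, Set.mem_ofPred_eq, Function.comp_apply]
    rw [Equiv.sum_comp σ fun i => x i ^ 2]
  have hii : ∀ i, Integrable (fun x : Fin (2 * k) → ℝ => x i * x i) μ := fun i =>
    (hL i).integrable_mul (hL i)
  obtain ⟨c, hc, h⟩ := exists_isIsotropic (by omega) hfm hprob hL
    (fun i x => by classical simp only [Set.indicator_apply, hflip])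
    (fun σ x => by classical simp only [Set.indicator_apply, hperm])
  refine ⟨μ, hprob, c, K, hc, ?_, h, hK, ?_, habs, fun α hα => ?_⟩
  · have h1 : ∫ x, ∑ i, x i * x i ∂μ = (2 * k : ℕ) * c := by
      rw [integral_finsetSum _ fun i _ => hii i]
      rw [Finset.sum_congr rfl fun i _ => h.integral_sq i]
      simp
    rw [← h1]
    have h2 : ∫ x, ∑ i, x i * x i ∂μ ≤ ∫ _, 1 ∂μ := by
      refine integral_mono_ae (integrable_finsetSum _ fun i _ => hii i)
        (integrable_const 1) (hmem.mono fun x hx => ?_)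
      simpa only [← sq] using hx.le
    simpa using h2
  · rw [hμr]
    gcongr
    exact Measure.restrict_le_self
  · rw [renyiInt_withDensity hfm]
    have h1 : ∀ x, B.indicator (fun _ => K) x ^ α = B.indicator (fun _ => K ^ α) x := fun x => by
      by_cases hx : x ∈ B <;> simp [hx, hα]
    simp only [h1]
    rw [lintegral_indicator_const hBm, hBv, hKd, ← ENNReal.ofReal_inv_of_pos hw0,
      ENNReal.ofReal_rpow_of_pos (by positivity), ← ENNReal.ofReal_mul (by positivity),
      Real.inv_rpow hw0.le, ← Real.rpow_neg hw0.le, sub_eq_neg_add, Real.rpow_add hw0,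
      Real.rpow_one]

end UniformBall

/-! ### The supremum for orders above one -/

section RatesAboveOne

variable {p : ℕ} {γ : ℕ → ℝ} {a : Fin p → ℝ} {v : ℝ≥0} {α : ℝ}

lemma le_of_mem_burgRenyiRates (hyw : YuleWalker γ p a v) (hv : v ≠ 0) (hα : 1 < α) {r : EReal}
    (hr : r ∈ burgRenyiRates.{u} γ p α) :
    r ≤ (((1 / 2) * Real.log (2 * Real.pi * Real.exp 1 * (v : ℝ)) : ℝ) : EReal) := by
  obtain ⟨Ω, _, P, X, hP, hX, hpdf, hlim⟩ := hr
  set c := (1 / 2) * Real.log (2 * Real.pi * Real.exp 1 * (v : ℝ)) with hc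
  refine le_of_tendsto_inv_mul
    (d := p * (1 / 2 * Real.log (2 * Real.pi) + γ 0 / 2) - p * c) ?_ hlim
  filter_upwards [eventually_ge_atTop p] with N hN
  obtain ⟨n, rfl⟩ := Nat.exists_eq_add_of_le hN
  refine (hX.renyiEntropy_le hyw hv hα n (hpdf _)).trans (EReal.coe_le_coe_iff.2 (le_of_eq ?_))
  push_cast
  ring

/-- The Stirling ratios `k! / (√(2k) (k/e)^k)` decrease from their value `e / √2` at `k = 1`. -/
lemma log_factorial_le {k : ℕ} (hk : 0 < k) :
    Real.log k.factorial ≤ 1 + 1 / 2 * Real.log k + k * Real.log k - k := by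
  obtain ⟨j, rfl⟩ := Nat.exists_eq_succ_of_ne_zero hk.ne'
  have h1 := Real.log_le_log (Stirling.stirlingSeq'_pos j)
    (Stirling.stirlingSeq'_antitone (Nat.zero_le j))
  simp only [Function.comp_apply, Nat.succ_eq_add_one, zero_add, Stirling.stirlingSeq_one] at h1
  rw [Stirling.log_stirlingSeq_formula, Real.log_div (Real.exp_ne_zero _) (by positivity),
    Real.log_exp, Real.log_sqrt (by norm_num), Real.log_mul (by norm_num) (by positivity),
    Real.log_div (by positivity) (Real.exp_ne_zero _), Real.log_exp] at h1
  simp only [Nat.succ_eq_add_one]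
  linarith

/-- The ball rescaled to variance `v` has the rate `½ log (v / c) + ½ log π - log k! / (2k)`,
whatever the order; the error term comes from the Stirling bound divided by `2k`. -/
lemma exists_mem_burgRenyiRates_ge (hγ : (toeplitz γ (p + 1)).PosDef) (hyw : YuleWalker γ p a v)
    (hv : v ≠ 0) (hα : 1 < α) {k : ℕ} (hk : 0 < k) :
    ∃ r : ℝ, (r : EReal) ∈ burgRenyiRates.{u} γ p α ∧
      1 / 2 * Real.log (2 * Real.pi * Real.exp 1 * v) -
        (1 / 2 * (k : ℝ)⁻¹ + 1 / 4 * (Real.log k / k)) ≤ r := by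
  obtain ⟨μ, _, c, K, hc, hkc, hμi, hK, hμK, habs, hI⟩ := exists_isIsotropic_ball hk
  have hv0 : 0 < (v : ℝ) := NNReal.coe_pos.2 (pos_iff_ne_zero.2 hv)
  have hm : 0 < 2 * k := by omega
  have hk0 : (0 : ℝ) < k := Nat.cast_pos.2 hk
  have hμ : μ ≪ volume :=
    (Measure.absolutelyContinuous_of_le hμK).trans Measure.smul_absolutelyContinuous
  set s := √((v : ℝ) / c) with hsd
  have hs : 0 < s := by positivity
  have hs2 : s ^ 2 = v / c := Real.sq_sqrt (by positivity)
  set T := LinearEquiv.smulOfNeZero ℝ (Fin (2 * k) → ℝ) s hs.ne' with hT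
  have h1 := hμi.map_smul hs.ne'
  rw [hs2, div_mul_cancel₀ _ hc.ne'] at h1
  have hprob : IsProbabilityMeasure (μ.map (linEquiv T)) :=
    Measure.isProbabilityMeasure_map (MeasurableEquiv.measurable _).aemeasurable
  have hν := absolutelyContinuous_map_linEquiv T hμ
  have hνI : renyiInt α (μ.map (linEquiv T)) =
      ENNReal.ofReal ((s ^ (2 * k) * (Real.pi ^ k / k.factorial)) ^ (1 - α)) := by
    rw [renyiInt_map_smul hμ hs (by linarith), hI α (by linarith),
      ← ENNReal.ofReal_mul (by positivity), ← Real.mul_rpow (by positivity) (by positivity)]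
  have hνK : μ.map (linEquiv T) ≤
      (K * ENNReal.ofReal |(LinearMap.det (T : (Fin (2 * k) → ℝ) →ₗ[ℝ] (Fin (2 * k) → ℝ)))⁻¹|) •
        volume := by
    refine (Measure.map_mono hμK (linEquiv T).measurable).trans ?_
    rw [Measure.map_smul, volume_map_linEquiv, smul_smul]
  have hνR : ∀ᵐ x ∂μ.map (linEquiv T), ∀ i, |x i| ≤ s := by
    rw [ae_map_iff (linEquiv T).measurable.aemeasurable]
    · filter_upwards [habs] with x hx i
      change |s * x i| ≤ s
      rw [abs_mul, abs_of_pos hs]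
      exact mul_le_of_le_one_right hs.le (hx i)
    · simp only [Set.ofPred_forall]
      exact MeasurableSet.iInter fun i =>
        measurableSet_le (measurable_pi_apply i).abs measurable_const
  have hmem := mem_burgRenyiRates.{u} hm hγ hyw h1 hν hα (by rw [hνI]; exact ENNReal.ofReal_ne_top)
    fun r hr => by
      rw [blockLaw_of_le hm _ hr.le]
      -- The dimension must be a free variable before it can be replaced by `r + t`.
      generalize hmd : 2 * k = m at *
      obtain ⟨t, rfl⟩ := Nat.exists_eq_add_of_le hr.le
      exact renyiInt_map_castAdd_ne_top (ENNReal.mul_ne_top hK ENNReal.ofReal_ne_top) hνK hνR hα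
  refine ⟨_, hmem, ?_⟩
  have hw : (0 : ℝ) < Real.pi ^ k / k.factorial := by positivity
  rw [hνI, ENNReal.toReal_ofReal (by positivity), Real.log_rpow (by positivity),
    inv_mul_cancel_left₀ (by linarith), Real.log_mul (by positivity) hw.ne', Real.log_pow,
    Real.log_div (by positivity) (by positivity), Real.log_pow, Real.log_sqrt (by positivity)]
  -- This is `2 k v ≤ v / c`, a restatement of `2k * c ≤ 1`.
  have h2 : Real.log 2 + Real.log k + Real.log v ≤ Real.log (v / c) := by
    rw [← Real.log_mul two_ne_zero hk0.ne', ← Real.log_mul (by positivity) hv0.ne']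
    refine Real.log_le_log (by positivity) ?_
    rw [le_div_iff₀ hc]
    push_cast at hkc
    nlinarith
  have h3 := log_factorial_le hk
  rw [Real.log_mul (by positivity) hv0.ne', Real.log_mul (by positivity) (Real.exp_ne_zero _),
    Real.log_mul two_ne_zero Real.pi_pos.ne', Real.log_exp]
  push_cast
  rw [le_div_iff₀ (by positivity)]
  have h4 := mul_le_mul_of_nonneg_left h2 hk0.le
  have h5 : (1 / 2 * (k : ℝ)⁻¹ + 1 / 4 * (Real.log k / k)) * (2 * k) = 1 + 1 / 2 * Real.log k := by
    field_simp
    ring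
  rw [sub_mul, h5]
  linarith

lemma sSup_burgRenyiRates_eq (hγ : (toeplitz γ (p + 1)).PosDef) (hyw : YuleWalker γ p a v)
    (hv : v ≠ 0) (hα : 1 < α) :
    sSup (burgRenyiRates.{u} γ p α) =
      (((1 / 2) * Real.log (2 * Real.pi * Real.exp 1 * (v : ℝ)) : ℝ) : EReal) := by
  refine le_antisymm (sSup_le fun r hr => le_of_mem_burgRenyiRates hyw hv hα hr) ?_
  set c := (1 / 2) * Real.log (2 * Real.pi * Real.exp 1 * (v : ℝ)) with hc
  have h1 : Tendsto (fun k : ℕ => c - (1 / 2 * (k : ℝ)⁻¹ + 1 / 4 * (Real.log k / k))) atTop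
      (𝓝 c) := by
    have h2 : Tendsto (fun k : ℕ => Real.log k / k) atTop (𝓝 0) :=
      (Real.isLittleO_log_id_atTop.tendsto_div_nhds_zero).comp tendsto_natCast_atTop_atTop
    have h3 := ((tendsto_inv_atTop_nhds_zero_nat (𝕜 := ℝ)).const_mul (1 / 2)).add
      (h2.const_mul (1 / 4))
    simpa using h3.const_sub c
  refine le_of_tendsto ((continuous_coe_real_ereal.tendsto c).comp h1) ?_
  filter_upwards [eventually_gt_atTop 0] with k hk
  obtain ⟨r, hr, hle⟩ := exists_mem_burgRenyiRates_ge.{u} hγ hyw hv hα hk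
  exact (EReal.coe_le_coe_iff.2 hle).trans (le_sSup hr)

end RatesAboveOne

theorem mainTheorem3 (p : ℕ) (γ : ℕ → ℝ) (hγ : (toeplitz γ (p + 1)).PosDef) :
    -- orders between zero and one
    (∀ α : ℝ, 0 < α → α < 1 → sSup (burgRenyiRates.{u} γ p α) = ⊤) ∧
    -- the Gauss-Markov process with the prescribed correlations exists
    (∃ (Ω : Type u) (_ : MeasurableSpace Ω) (P : Measure Ω) (X : ℕ → Ω → ℝ)
      (a : Fin p → ℝ) (v : ℝ≥0),
      IsProbabilityMeasure P ∧ IsGaussMarkov γ p a v P X ∧ SatisfiesBurg γ p P X) ∧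
    -- its Shannon rate, which is the supremum for all orders above one
    (∀ (Ω : Type u) [MeasurableSpace Ω] (P : Measure Ω) [IsProbabilityMeasure P]
      (X : ℕ → Ω → ℝ) (a : Fin p → ℝ) (v : ℝ≥0),
      IsGaussMarkov γ p a v P X → SatisfiesBurg γ p P X →
        0 < v ∧
        HasShannonRate P X
          (((1 / 2) * Real.log (2 * Real.pi * Real.exp 1 * (v : ℝ)) : ℝ) : EReal) ∧
        ∀ α : ℝ, 1 < α → sSup (burgRenyiRates.{u} γ p α) =
          (((1 / 2) * Real.log (2 * Real.pi * Real.exp 1 * (v : ℝ)) : ℝ) : EReal)) := by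
  refine ⟨fun α hα0 hα1 => sSup_burgRenyiRates_eq_top hγ hα0 hα1, exists_isGaussMarkov p γ hγ, ?_⟩
  intro Ω _ P _ X a v h hX
  have hyw := h.yuleWalker hX
  have hv : 0 < v := NNReal.coe_pos.1 (hyw.pos hγ)
  exact ⟨hv, h.hasShannonRate hX hγ, fun α hα => sSup_burgRenyiRates_eq hγ hyw hv.ne' hα⟩
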